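/- All rings are commutative with identity. Let $A$ be a ring, $N$ an $A$-module and $\mathbf{x}=x_1,\dots,x_\ell$ a finite sequence in $A$. The sequence $\mathbf{x}$ is \emph{weakly $N$-regular} if $x_i$ is a non-zero-divisor on $N/(x_1,\dots,x_{i-1})N$ for $i=1,\dots,\ell$, and \emph{$N$-regular} if moreover $\mathbf{x}N\neq N$. It is \emph{$N$-weakly proregular} if for every $n$ there is $m\ge n$ such that the natural maps of Koszul homology $H_i(x_1^m,\dots,x_\ell^m;N)\to H_i(x_1^n,\dots,x_\ell^n;N)$ are zero for all $i\ge 1$. It is a \emph{parameter sequence on $N$} if it is $N$-weakly proregular, $\mathbf{x}N\ne N$, and the top \v{C}ech cohomology satisfies $H^{\ell}_{\mathbf{x}}(N)_{\mathfrak p}\neq 0$ for every $\mathfrak p\in\operatorname{Supp}_A(N/\mathbf{x}N)$; it is a \emph{strong parameter sequence on $N$} if $x_1,\dots,x_i$ is a parameter sequence on $N$ for $i=1,\dots,\ell$. The $A$-module $N$ is \emph{Cohen-Macaulay} if every strong parameter sequence on $N$ is $N$-regular (the empty sequence being regarded as regular), and the ring $A$ is Cohen-Macaulay if it is so as an $A$-module.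 $N$ is \emph{maximal Cohen-Macaulay} if it is Cohen-Macaulay and $\dim N=\dim A$. The trivial extension $A\ltimes N$ is the ring with additive group $A\oplus N$ and multiplication $(a,u)(b,v)=(ab,av+bu)$. Let $R$ be a Noetherian local ring and $M$ a nonzero finitely generated $R$-module. Then the following statements are equivalent: \begin{enumerate} \item $R\ltimes M$ is Cohen-Macaulay; \item $R$ is Cohen-Macaulay and every $R$-regular sequence is an $M$-regular sequence; \item $R$ is Cohen-Macaulay and $M$ is maximal Cohen-Macaulay. \end{enumerate} -/

import Mathlib

noncomputable section

namespace TrivExtCM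

/-! ### Koszul complexes and weakly proregular sequences -/

section Koszul

variable {R : Type*} [CommRing R] (M : Type*) [AddCommGroup M] [Module R M] {l : ℕ}

/-- The degree `i` term of the Koszul complex on a sequence of length `l` with coefficients in `M`:
a direct sum of copies of `M` indexed by the `i`-element subsets of the index set. -/
abbrev KoszulChain (l i : ℕ) : Type _ := {s : Finset (Fin l) // s.card = i} → M

/-- The Koszul differential `K_{i+1}(x, M) → K_i(x, M)`: the basis vector `e_s ⊗ m` goes to
`∑_{j ∈ s} ± x_j e_{s \ {j}} ⊗ m`, where the sign is `(-1) ^ #{k ∈ s | k < j}`.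
Below it is written coordinate by coordinate, with `s = t ∪ {j}`. -/
def koszulD (x : Fin l → R) (i : ℕ) : KoszulChain M l (i + 1) →ₗ[R] KoszulChain M l i where
  toFun f t := ∑ j : Fin l, if h : j ∉ t.1 then
    ((-1 : R) ^ (t.1.filter (· < j)).card * x j) •
      f ⟨insert j t.1, by rw [Finset.card_insert_of_notMem h, t.2]⟩ else 0
  map_add' f g := by
    funext t
    simp only [Pi.add_apply, ← Finset.sum_add_distrib]
    refine Finset.sum_congr rfl fun j _ => ?_
    split_ifs <;> simp
  map_smul' r f := by
    funext t
    simp only [Pi.smul_apply, RingHom.id_apply, Finset.smul_sum]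
    refine Finset.sum_congr rfl fun j _ => ?_
    by_cases hj : j ∈ t.1
    · simp [hj]
    · simp only [hj, not_false_eq_true, dite_true]
      exact smul_comm _ _ _

/-- The degree `i` component of the chain map `K(x ^ m, M) → K(x ^ n, M)` (for `n ≤ m`), the tensor
product over `j` of the maps `K(x_j ^ m) → K(x_j ^ n)` which are the identity in degree `0` and
multiplication by `x_j ^ (m - n)` in degree `1`. -/
def koszulTrans (x : Fin l → R) (m n i : ℕ) : KoszulChain M l i →ₗ[R] KoszulChain M l i where
  toFun f s := (∏ j ∈ s.1, x j ^ (m - n)) • f s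
  map_add' f g := by funext s; simp
  map_smul' r f := by funext s; exact smul_comm _ _ _

/-- `x` is `M`-weakly proregular: for each `n` there is `m ≥ n` such that the induced maps
`H_i(x ^ m, M) → H_i(x ^ n, M)` vanish for all `i ≥ 1`, i.e. every cycle of positive degree is sent
to a boundary. (The degree `i ≥ 1` is written `i + 1`.) -/
def IsWeaklyProregular (x : Fin l → R) : Prop :=
  ∀ n : ℕ, ∃ m : ℕ, n ≤ m ∧ ∀ i : ℕ,
    ∀ z ∈ LinearMap.ker (koszulD M (fun j => x j ^ m) i),
      koszulTrans M x m n (i + 1) z ∈ LinearMap.range (koszulD M (fun j => x j ^ n) (i + 1))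

end Koszul

/-! ### Top Čech cohomology -/

section Cech

variable {R : Type*} [CommRing R] (M : Type*) [AddCommGroup M] [Module R M] {l : ℕ}

/-- The localization `M_{x_s}` of `M` at the product `x_s` of the elements `x_j`, `j ∈ s`. -/
abbrev CechTerm (x : Fin l → R) (s : Finset (Fin l)) : Type _ :=
  LocalizedModule (Submonoid.powers (∏ j ∈ s, x j)) M

lemma isUnit_cechTerm (x : Fin l → R) {s t : Finset (Fin l)} (h : s ⊆ t)
    (a : Submonoid.powers (∏ j ∈ s, x j)) :
    IsUnit (algebraMap R (Module.End R (CechTerm M x t)) a) := by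
  obtain ⟨_, k, rfl⟩ := a
  have hu : IsUnit (algebraMap R (Module.End R (CechTerm M x t)) (∏ j ∈ t, x j)) :=
    IsLocalizedModule.map_units (LocalizedModule.mkLinearMap _ M)
      (⟨_, Submonoid.mem_powers _⟩ : Submonoid.powers (∏ j ∈ t, x j))
  have he := congrArg (algebraMap R (Module.End R (CechTerm M x t))) (Finset.prod_sdiff (f := x) h)
  rw [map_mul] at he
  rw [← he] at hu
  have hc : Commute (algebraMap R (Module.End R (CechTerm M x t)) (∏ j ∈ t \ s, x j))
      (algebraMap R (Module.End R (CechTerm M x t)) (∏ j ∈ s, x j)) :=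
    Algebra.commutes _ _
  simpa using (hc.isUnit_mul_iff.mp hu).2.pow k

/-- The natural localization map `M_{x_s} → M_{x_t}` for `s ⊆ t`. -/
def cechMap (x : Fin l → R) {s t : Finset (Fin l)} (h : s ⊆ t) :
    CechTerm M x s →ₗ[R] CechTerm M x t :=
  LocalizedModule.lift _ (LocalizedModule.mkLinearMap _ M) (isUnit_cechTerm M x h)

/-- The top Čech cohomology `H^l_x(M)` of a sequence `x` of length `l`. The last differential of
the Čech complex is, up to signs of the components, the map
`⨁_j M_{x_1 ⋯ x_l / x_j} → M_{x_1 ⋯ x_l}` given by the localization maps, and the next term is `0`;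
so the top cohomology is the quotient by the sum of the images. -/
abbrev TopCech (x : Fin l → R) : Type _ :=
  CechTerm M x Finset.univ ⧸
    ⨆ j : Fin l, LinearMap.range (cechMap M x (Finset.subset_univ (Finset.univ.erase j)))

end Cech

/-! ### Parameter sequences and Cohen-Macaulay modules -/

section CM

variable (R : Type*) [CommRing R] (M : Type*) [AddCommGroup M] [Module R M]

/-- Parameter sequences on a module. -/
structure IsParameterSeq (rs : List R) : Prop where
  weaklyProregular : IsWeaklyProregular M rs.get
  smul_ne_top : Ideal.ofList rs • (⊤ : Submodule R M) ≠ ⊤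
  topCech_ne_zero : ∀ p ∈ Module.support R (M ⧸ (Ideal.ofList rs • ⊤ : Submodule R M)),
    Nontrivial (LocalizedModule p.asIdeal.primeCompl (TopCech M rs.get))

/-- Strong parameter sequences: every nonempty initial segment is a parameter sequence. -/
def IsStrongParameterSeq (rs : List R) : Prop :=
  ∀ i : ℕ, 1 ≤ i → i ≤ rs.length → IsParameterSeq R M (rs.take i)

/-- `M` is Cohen-Macaulay if every strong parameter sequence on `M` is `M`-regular; the empty
sequence counts as regular on every module, including the zero module. -/
def IsCohenMacaulay : Prop :=
  ∀ rs : List R, IsStrongParameterSeq R M rs → rs = [] ∨ RingTheory.Sequence.IsRegular M rs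

/-- `M` is maximal Cohen-Macaulay if it is Cohen-Macaulay and `dim M = dim R`. -/
def IsMaximalCohenMacaulay : Prop :=
  IsCohenMacaulay R M ∧ Module.supportDim R M = ringKrullDim R

end CM

end TrivExtCM

end

/-!
Over a Noetherian ring weak proregularity is automatic for finitely generated modules: each `x_j`
annihilates the Koszul homology of `x`, so Artin–Rees makes the transition maps vanish. As the top
Čech cohomology `H_x(N)` is the colimit of the modules `N / (x ^ t)N`, its nonvanishing at a prime
is an elementary condition, and for a regular sequence the maps `N / (x ^ t)N → H_x(N)` are
injective; so regular sequences are strong parameter sequences.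

A nonzero finitely generated module `N` over a Noetherian local ring is Cohen–Macaulay in the
present sense if and only if its depth equals its dimension. If `x` is regular on a Cohen–Macaulay
`N` with `dim N / xN > 0`, let `y` be a nonunit outside the minimal primes of `N / xN`. Then `x, y`
is a parameter sequence, hence regular. For otherwise, localize at a prime minimal in the support
of `N / (x, y)N`, where `H_{x,y}(N)` vanishes. The elements of `E = H_x(N)` killed by `x` form a
copy of `N / xN`, so they are a finite module. This finiteness passes to the quotient by the
`y`-power torsion `T` of `E`, which is Artinian. The vanishing of `H_{x,y}(N)` makes `y` bijective
on the elements of `E / T` killed by `x`, and Nakayama gives `N / xN ⊆ T`, contradicting the choice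
of `y`. Conversely, if the depth of `N` is its dimension, then `N / xN` has no embedded primes for
regular `x`, because the depth is at most `dim R / p` for an associated prime `p`. Since
`H_{x,y}(N)` vanishes at the minimal primes of `N / xN` which contain `y`, a parameter sequence
`x, y` is regular.

If `M` is maximal Cohen–Macaulay, `x` is regular on `M` and `p` is an associated prime of `M / xM`,
then `dim R / p ≥ dim R - |x|`; so `p` cannot contain `y` if `x, y` is regular on `R`.

The kernel of the surjection `R ⋉ M → R` has square zero, so the two rings have the same parameter
sequences, and `0 → M → R ⋉ M → R → 0` shows that a sequence is regular on `R ⋉ M` when it is so on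
`R` and `M`.
-/

noncomputable section

open Pointwise RingTheory.Sequence

namespace TrivExtCM

section TopCech

variable {R : Type*} [CommRing R] {N : Type*} [AddCommGroup N] [Module R N] {l : ℕ}

variable (N) in
lemma prod_pow_smul_mem (x : Fin l → R) {a : ℕ} (u : ℕ) {n : N}
    (hn : n ∈ (Ideal.span (Set.range (x ^ a)) • ⊤ : Submodule R N)) :
    (∏ j, x j) ^ u • n ∈ (Ideal.span (Set.range (x ^ (a + u))) • ⊤ : Submodule R N) := by
  suffices h : (Ideal.span (Set.range (x ^ a)) • ⊤ : Submodule R N) ≤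
      (Ideal.span (Set.range (x ^ (a + u))) • ⊤ : Submodule R N).comap
        (LinearMap.lsmul R N ((∏ j, x j) ^ u)) from h hn
  rw [Submodule.span_smul_eq, Submodule.set_smul_le_iff]
  rintro _ m ⟨j, rfl⟩ -
  have h : (∏ j, x j) ^ u * x j ^ a =
      x j ^ (a + u) * (∏ i ∈ Finset.univ.erase j, x i) ^ u := by
    rw [← Finset.mul_prod_erase _ x (Finset.mem_univ j)]
    ring
  rw [Submodule.mem_comap, LinearMap.lsmul_apply, smul_smul, Pi.pow_apply, h, mul_smul]
  exact Submodule.smul_mem_smul (Ideal.subset_span ⟨j, rfl⟩) trivial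

lemma mk_prod_pow_smul (x : Fin l → R) (t u : ℕ) (m : N) :
    (LocalizedModule.mk ((∏ j, x j) ^ u • m) (Submonoid.pow _ (t + u)) :
      CechTerm N x Finset.univ) = LocalizedModule.mk m (Submonoid.pow _ t) := by
  have h : Submonoid.pow (∏ j, x j) (t + u) = Submonoid.pow _ t * Submonoid.pow _ u :=
    Subtype.ext (pow_add _ t u)
  rw [h]
  exact LocalizedModule.mk_cancel_common_right _ (Submonoid.pow _ u) m

lemma cechMap_erase_mk (x : Fin l → R) (j : Fin l) (t : ℕ) (m : N) :
    cechMap N x (Finset.subset_univ (Finset.univ.erase j))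
      (LocalizedModule.mk m (Submonoid.pow _ t)) =
      LocalizedModule.mk (x j ^ t • m) (Submonoid.pow _ t) := by
  have h : (∏ i ∈ Finset.univ.erase j, x i) ^ t * x j ^ t = (∏ i, x i) ^ t := by
    rw [← mul_pow, Finset.prod_erase_mul _ _ (Finset.mem_univ j)]
  rw [cechMap, LocalizedModule.lift_mk, Module.End.algebraMap_isUnit_inv_apply_eq_iff]
  change LocalizedModule.mk m 1 = (∏ i ∈ Finset.univ.erase j, x i) ^ t • LocalizedModule.mk _ _
  rw [LocalizedModule.smul'_mk, smul_smul, h]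
  exact (LocalizedModule.mk_cancel (Submonoid.pow (∏ i, x i) t) m).symm

lemma mem_iSup_range_cechMap_iff (x : Fin l → R) (ξ : CechTerm N x Finset.univ) :
    ξ ∈ ⨆ j : Fin l, LinearMap.range
        (cechMap N x (Finset.subset_univ (Finset.univ.erase j))) ↔
      ∃ t, ∃ n ∈ (Ideal.span (Set.range (x ^ t)) • ⊤ : Submodule R N),
        LocalizedModule.mk n (Submonoid.pow _ t) = ξ := by
  constructor
  · intro hξ
    induction hξ using Submodule.iSup_induction' with
    | mem j ξ hξ =>
      obtain ⟨η, rfl⟩ := hξ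
      induction η using LocalizedModule.induction_on with
      | h n s =>
        obtain ⟨_, t, rfl⟩ := s
        exact ⟨t, x j ^ t • n, Submodule.smul_mem_smul (Ideal.subset_span ⟨j, rfl⟩) trivial,
          (cechMap_erase_mk x j t n).symm⟩
    | zero => exact ⟨0, 0, zero_mem _, LocalizedModule.zero_mk _⟩
    | add ξ η _ _ hξ hη =>
      obtain ⟨a, n, hn, rfl⟩ := hξ
      obtain ⟨b, n', hn', rfl⟩ := hη
      refine ⟨a + b, (∏ j, x j) ^ b • n + (∏ j, x j) ^ a • n',
        add_mem (prod_pow_smul_mem N x b hn) ?_, ?_⟩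
      · rw [add_comm a b]
        exact prod_pow_smul_mem N x a hn'
      · rw [LocalizedModule.mk_add_mk]
        exact congrArg _ (Subtype.ext (pow_add _ a b))
  · rintro ⟨t, n, hn, rfl⟩
    let divPow : N →ₗ[R] CechTerm N x Finset.univ :=
      LocalizedModule.divBy (Submonoid.pow _ t) ∘ₗ LocalizedModule.mkLinearMap _ N
    have hdivPow (m : N) : divPow m = LocalizedModule.mk m (Submonoid.pow _ t) := by
      simp only [divPow, LinearMap.comp_apply, LocalizedModule.mkLinearMap_apply,
        LocalizedModule.divBy_apply, LocalizedModule.liftOn_mk, one_mul]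
    suffices h : (Ideal.span (Set.range (x ^ t)) • ⊤ : Submodule R N) ≤
        Submodule.comap divPow (⨆ j : Fin l, LinearMap.range
          (cechMap N x (Finset.subset_univ (Finset.univ.erase j)))) from hdivPow n ▸ h hn
    rw [Submodule.span_smul_eq, Submodule.set_smul_le_iff]
    rintro _ m ⟨j, rfl⟩ -
    rw [Submodule.mem_comap, hdivPow]
    exact Submodule.mem_iSup_of_mem j ⟨_, cechMap_erase_mk x j t m⟩

variable (N) in
/-- The map sending `m` to the class of the fraction `m / (x_1 ⋯ x_l) ^ t` in the top Čech
cohomology. Every class arises in this way, for some `t`. -/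
def cechClass (x : Fin l → R) (t : ℕ) : N →ₗ[R] TopCech N x :=
  Submodule.mkQ _ ∘ₗ LocalizedModule.divBy (Submonoid.pow _ t) ∘ₗ LocalizedModule.mkLinearMap _ N

lemma cechClass_apply (x : Fin l → R) (t : ℕ) (m : N) :
    cechClass N x t m = Submodule.Quotient.mk (LocalizedModule.mk m (Submonoid.pow _ t)) := by
  simp only [cechClass, LinearMap.comp_apply, LocalizedModule.mkLinearMap_apply,
    LocalizedModule.divBy_apply, LocalizedModule.liftOn_mk, one_mul, Submodule.mkQ_apply]

lemma exists_cechClass_eq (x : Fin l → R) (ξ : TopCech N x) : ∃ t m, cechClass N x t m = ξ := by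
  obtain ⟨ξ, rfl⟩ := Submodule.mkQ_surjective _ ξ
  induction ξ using LocalizedModule.induction_on with
  | h m s =>
    obtain ⟨_, t, rfl⟩ := s
    exact ⟨t, m, cechClass_apply x t m⟩

lemma cechClass_add_pow (x : Fin l → R) (t u : ℕ) (m : N) :
    cechClass N x (t + u) ((∏ j, x j) ^ u • m) = cechClass N x t m := by
  rw [cechClass_apply, cechClass_apply, mk_prod_pow_smul]

lemma cechClass_eq_zero_iff (x : Fin l → R) (t : ℕ) (m : N) :
    cechClass N x t m = 0 ↔ ∃ u, (∏ j, x j) ^ u • m ∈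
      (Ideal.span (Set.range (x ^ (t + u))) • ⊤ : Submodule R N) := by
  rw [cechClass_apply, Submodule.Quotient.mk_eq_zero, mem_iSup_range_cechMap_iff]
  constructor
  · rintro ⟨t', n, hn, h⟩
    obtain ⟨⟨_, v, rfl⟩, h⟩ := LocalizedModule.mk_eq.1 h
    have h' : (∏ j, x j) ^ (v + t') • m = (∏ j, x j) ^ (v + t) • n := by
      simp only [pow_add, mul_smul]
      exact h.symm
    refine ⟨v + t', ?_⟩
    rw [h', show t + (v + t') = t' + (v + t) by ring]
    exact prod_pow_smul_mem N x _ hn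
  · rintro ⟨u, h⟩
    exact ⟨t + u, _, h, mk_prod_pow_smul x t u m⟩

lemma ofList_map_pow_eq_span_range (rs : List R) (n : ℕ) :
    Ideal.ofList (rs.map (· ^ n)) = Ideal.span (Set.range (rs.get ^ n)) := by
  refine congrArg Ideal.span (Set.ext fun r => List.mem_map.trans ?_)
  simp only [List.mem_iff_get, exists_exists_eq_and, Set.mem_range, Pi.pow_apply]

lemma prod_get_eq_prod (rs : List R) : ∏ j, rs.get j = rs.prod :=
  Fin.prod_univ_getElem rs

lemma cechClass_get_eq_zero_iff (rs : List R) (t : ℕ) (m : N) :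
    cechClass N rs.get t m = 0 ↔ ∃ u, rs.prod ^ u • m ∈
      (Ideal.ofList (rs.map (· ^ (t + u))) • ⊤ : Submodule R N) := by
  simp_rw [cechClass_eq_zero_iff, ofList_map_pow_eq_span_range, prod_get_eq_prod]

lemma list_prod_pow_smul_mem (rs : List R) {a : ℕ} (u : ℕ) {n : N}
    (hn : n ∈ (Ideal.ofList (rs.map (· ^ a)) • ⊤ : Submodule R N)) :
    rs.prod ^ u • n ∈ (Ideal.ofList (rs.map (· ^ (a + u))) • ⊤ : Submodule R N) := by
  rw [ofList_map_pow_eq_span_range] at hn ⊢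
  rw [← prod_get_eq_prod]
  exact prod_pow_smul_mem N _ u hn

variable (N) in
/-- An elementary form of the nonvanishing of the localization at `p` of the top Čech cohomology of
the sequence `rs`: since `H^l(N) = colim_t N / (rs ^ t) N` with transition maps multiplication by
the product of `rs`, it says that some class `m / (rs.prod) ^ t` is killed by no `s ∉ p`. -/
def TopNonzeroAt (rs : List R) (p : Ideal R) : Prop :=
  ∃ (t : ℕ) (m : N), ∀ s ∉ p, ∀ u, s • rs.prod ^ u • m ∉
    (Ideal.ofList (rs.map (· ^ (t + u))) • ⊤ : Submodule R N)

lemma nontrivial_localizedModule_topCech_iff (rs : List R) (p : Ideal R) [p.IsPrime] :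
    Nontrivial (LocalizedModule p.primeCompl (TopCech N rs.get)) ↔ TopNonzeroAt N rs p := by
  rw [← not_subsingleton_iff_nontrivial, LocalizedModule.subsingleton_iff]
  push Not
  constructor
  · rintro ⟨ξ, hξ⟩
    obtain ⟨t, m, rfl⟩ := exists_cechClass_eq _ ξ
    refine ⟨t, m, fun s hs u hu => hξ s hs ?_⟩
    rw [← map_smul, cechClass_get_eq_zero_iff]
    exact ⟨u, by rwa [smul_comm]⟩
  · rintro ⟨t, m, h⟩
    refine ⟨cechClass N rs.get t m, fun s hs h0 => ?_⟩
    rw [← map_smul, cechClass_get_eq_zero_iff] at h0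
    obtain ⟨u, hu⟩ := h0
    exact h s hs u (by rwa [smul_comm])

lemma TopNonzeroAt.mono {rs : List R} {p q : Ideal R} (h : TopNonzeroAt N rs p) (hpq : p ≤ q) :
    TopNonzeroAt N rs q := by
  obtain ⟨t, m, h⟩ := h
  exact ⟨t, m, fun s hs => h s fun hp => hs (hpq hp)⟩

end TopCech

section Koszul

variable {R : Type*} [CommRing R] {N : Type*} [AddCommGroup N] [Module R N] {l i : ℕ}

/-- The sign `(-1) ^ #{k ∈ t | k < j}` of the Koszul differential. -/
def koszulSign (R : Type*) [CommRing R] (t : Finset (Fin l)) (j : Fin l) : R :=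
  (-1) ^ (t.filter (· < j)).card

lemma koszulSign_mul_self (t : Finset (Fin l)) (j : Fin l) :
    koszulSign R t j * koszulSign R t j = 1 := by
  rw [koszulSign, ← mul_pow, neg_one_mul, neg_neg, one_pow]

lemma koszulSign_insert {t : Finset (Fin l)} {j k : Fin l} (hk : k ∉ t) :
    koszulSign R (insert k t) j = (if k < j then -1 else 1) * koszulSign R t j := by
  rw [koszulSign, koszulSign, Finset.filter_insert]
  split_ifs with h
  · rw [Finset.card_insert_of_notMem (fun hk' => hk (Finset.mem_of_mem_filter k hk')), pow_succ']
  · rw [one_mul]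

lemma koszulSign_swap {t : Finset (Fin l)} {j k : Fin l} (hj : j ∉ t) (hk : k ∉ t) (hjk : k ≠ j) :
    koszulSign R (insert j t) k * koszulSign R (insert k t) j =
      -(koszulSign R t j * koszulSign R t k) := by
  rw [koszulSign_insert hj, koszulSign_insert hk]
  rcases lt_or_gt_of_ne hjk with h | h <;> rw [if_neg h.not_gt, if_pos h] <;> ring

/-- The coefficient of a Koszul chain at an arbitrary finite set, zero if the cardinality of the set
is not the degree of the chain; it spares cardinality proofs in computations. -/
def koszulCoeff (f : KoszulChain N l i) (s : Finset (Fin l)) : N :=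
  if h : s.card = i then f ⟨s, h⟩ else 0

lemma koszulCoeff_coe (f : KoszulChain N l i) (s : {s : Finset (Fin l) // s.card = i}) :
    koszulCoeff f s.1 = f s :=
  dif_pos s.2

lemma koszulD_apply (x : Fin l → R) (f : KoszulChain N l (i + 1))
    (t : {s : Finset (Fin l) // s.card = i}) :
    koszulD N x i f t =
      ∑ j ∈ t.1ᶜ, (koszulSign R t.1 j * x j) • koszulCoeff f (insert j t.1) := by
  rw [← Finset.univ_inter t.1ᶜ, ← Finset.sum_ite_mem, koszulD, LinearMap.coe_mk, AddHom.coe_mk]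
  refine Finset.sum_congr rfl fun j _ => ?_
  by_cases hj : j ∈ t.1
  · rw [dif_neg (not_not.2 hj), if_neg (fun h => Finset.mem_compl.1 h hj)]
  · rw [dif_pos hj, if_pos (Finset.mem_compl.2 hj), ← koszulCoeff_coe f]
    rfl

/-- Exterior multiplication of Koszul chains by the `j`-th basis vector `e_j`. -/
def koszulWedge (R : Type*) [CommRing R] [Module R N] (j : Fin l) (f : KoszulChain N l i) :
    KoszulChain N l (i + 1) :=
  fun s => if j ∈ s.1 then koszulSign R (s.1.erase j) j • koszulCoeff f (s.1.erase j) else 0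

lemma koszulCoeff_koszulWedge_insert (j : Fin l) (f : KoszulChain N l i) {s : Finset (Fin l)}
    (hj : j ∉ s) :
    koszulCoeff (koszulWedge R j f) (insert j s) = koszulSign R s j • koszulCoeff f s := by
  by_cases hs : s.card = i
  · have hs' : (insert j s).card = i + 1 := by rw [Finset.card_insert_of_notMem hj, hs]
    rw [koszulCoeff, dif_pos hs', koszulWedge, if_pos (Finset.mem_insert_self j s),
      Finset.erase_insert hj]
  · have hs' : (insert j s).card ≠ i + 1 := by
      rw [Finset.card_insert_of_notMem hj]
      omega
    rw [koszulCoeff, dif_neg hs', koszulCoeff, dif_neg hs, smul_zero]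

lemma koszulCoeff_koszulWedge_of_notMem (j : Fin l) (f : KoszulChain N l i) {s : Finset (Fin l)}
    (hj : j ∉ s) : koszulCoeff (koszulWedge R j f) s = 0 := by
  unfold koszulCoeff koszulWedge
  split_ifs <;> rfl

/-- Contraction against `x` is an antiderivation, so `e_j ∧ -` is a homotopy between multiplication
by `x j` and zero: the Koszul homology is annihilated by the sequence. -/
lemma koszulD_koszulWedge_add (x : Fin l → R) (j : Fin l) (f : KoszulChain N l (i + 1)) :
    koszulD N x (i + 1) (koszulWedge R j f) + koszulWedge R j (koszulD N x i f) = x j • f := by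
  funext t
  rw [Pi.add_apply, koszulD_apply, Pi.smul_apply, ← koszulCoeff_coe f,
    ← koszulCoeff_coe (koszulWedge R j _)]
  by_cases hj : j ∈ t.1
  · obtain ⟨s, hjs, hst⟩ : ∃ s, j ∉ s ∧ insert j s = t.1 :=
      ⟨t.1.erase j, Finset.notMem_erase j _, Finset.insert_erase hj⟩
    have hs : s.card = i := by
      have := t.2
      rw [← hst, Finset.card_insert_of_notMem hjs] at this
      omega
    have hanti {k : Fin l} (hk : k ∈ (insert j s)ᶜ) :
        (koszulSign R (insert j s) k * x k) •
            koszulCoeff (koszulWedge R j f) (insert k (insert j s)) =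
          -(koszulSign R s j • (koszulSign R s k * x k) • koszulCoeff f (insert k s)) := by
      obtain ⟨hkj, hks⟩ : k ≠ j ∧ k ∉ s := by
        simpa only [Finset.mem_compl, Finset.mem_insert, not_or] using hk
      rw [Finset.insert_comm, koszulCoeff_koszulWedge_insert j f (by simp [hkj.symm, hjs]),
        smul_smul, smul_smul, ← neg_smul]
      congr 1
      linear_combination x k * koszulSign_swap (R := R) hjs hks hkj
    rw [← hst, koszulCoeff_koszulWedge_insert j _ hjs, koszulCoeff_coe _ ⟨s, hs⟩, koszulD_apply,
      ← Finset.insert_compl_insert hjs, Finset.sum_insert (by simp), smul_add, Finset.smul_sum,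
      Finset.sum_congr rfl fun k hk => hanti hk, Finset.sum_neg_distrib, neg_add_cancel_comm_assoc,
      smul_smul, ← mul_assoc, koszulSign_mul_self, one_mul]
  · rw [koszulCoeff_koszulWedge_of_notMem j _ hj, add_zero, Finset.sum_eq_single_of_mem j
      (Finset.mem_compl.2 hj), koszulCoeff_koszulWedge_insert j f hj, smul_smul,
      mul_right_comm, koszulSign_mul_self, one_mul]
    intro k _ hkj
    rw [koszulCoeff_koszulWedge_of_notMem j f (by simp [hkj.symm, hj]), smul_zero]

lemma smul_mem_range_koszulD (x : Fin l → R) (j : Fin l) {z : KoszulChain N l (i + 1)}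
    (hz : koszulD N x i z = 0) : x j • z ∈ LinearMap.range (koszulD N x (i + 1)) := by
  have hwedge : koszulWedge R j (0 : KoszulChain N l i) = 0 := by
    funext s
    simp [koszulWedge, koszulCoeff]
  exact ⟨koszulWedge R j z, by rw [← koszulD_koszulWedge_add x j z, hz, hwedge, add_zero]⟩

lemma koszulTrans_apply (x : Fin l → R) (m n : ℕ) (f : KoszulChain N l i)
    (s : {s : Finset (Fin l) // s.card = i}) :
    koszulTrans N x m n i f s = (∏ j ∈ s.1, x j ^ (m - n)) • f s := rfl

lemma koszulCoeff_koszulTrans (x : Fin l → R) (m n : ℕ) (f : KoszulChain N l i)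
    (s : Finset (Fin l)) :
    koszulCoeff (koszulTrans N x m n i f) s = (∏ j ∈ s, x j ^ (m - n)) • koszulCoeff f s := by
  unfold koszulCoeff
  split_ifs
  · rfl
  · rw [smul_zero]

lemma koszulD_koszulTrans (x : Fin l → R) {m n : ℕ} (hnm : n ≤ m) (f : KoszulChain N l (i + 1)) :
    koszulD N (fun j => x j ^ n) i (koszulTrans N x m n (i + 1) f) =
      koszulTrans N x m n i (koszulD N (fun j => x j ^ m) i f) := by
  funext t
  rw [koszulD_apply, koszulTrans_apply, koszulD_apply, Finset.smul_sum]
  refine Finset.sum_congr rfl fun j hj => ?_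
  rw [koszulCoeff_koszulTrans, Finset.prod_insert (Finset.mem_compl.1 hj), smul_smul, smul_smul]
  congr 1
  linear_combination (koszulSign R t.1 j * ∏ k ∈ t.1, x k ^ (m - n)) * pow_mul_pow_sub (x j) hnm

lemma koszulTrans_mem_pow_smul_top (x : Fin l → R) (m n : ℕ) (z : KoszulChain N l (i + 1)) :
    koszulTrans N x m n (i + 1) z ∈
      (Ideal.span (Set.range x) ^ (m - n) • ⊤ : Submodule R (KoszulChain N l (i + 1))) := by
  classical
  rw [← Finset.univ_sum_single (koszulTrans N x m n (i + 1) z)]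
  refine Submodule.sum_mem _ fun s _ => ?_
  rw [koszulTrans_apply, Pi.single_smul]
  refine Submodule.smul_mem_smul ?_ trivial
  obtain ⟨j, hj⟩ : s.1.Nonempty := Finset.card_pos.1 (s.2.symm ▸ i.succ_pos)
  rw [← Finset.mul_prod_erase _ _ hj]
  exact Ideal.mul_mem_right _ _ (Ideal.pow_mem_pow (Ideal.subset_span (Set.mem_range_self j)) _)

/-- By Artin–Rees, for `m ≫ n` a cycle lying in `I ^ (m - n) K`, where `I` is generated by the
sequence, lies in `I ^ a Z ⊆ (x ^ n) Z`, and `x ^ n` annihilates the homology of `K(x ^ n)`. -/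
lemma exists_forall_koszulTrans_mem_range [IsNoetherianRing R] [Module.Finite R N]
    (x : Fin l → R) (n i : ℕ) : ∃ m₀, ∀ m ≥ m₀, n ≤ m ∧
      ∀ z ∈ LinearMap.ker (koszulD N (fun j => x j ^ m) i),
        koszulTrans N x m n (i + 1) z ∈ LinearMap.range (koszulD N (fun j => x j ^ n) (i + 1)) := by
  set I := Ideal.span (Set.range x)
  set J := Ideal.span (Set.range fun j => x j ^ n)
  set Z := LinearMap.ker (koszulD N (fun j => x j ^ n) i)
  obtain ⟨a, ha⟩ : ∃ a, I ^ a ≤ J := by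
    refine Ideal.exists_pow_le_of_le_radical_of_fg (Ideal.span_le.2 ?_) (IsNoetherian.noetherian I)
    rintro _ ⟨j, rfl⟩
    exact ⟨n, Ideal.subset_span ⟨j, rfl⟩⟩
  obtain ⟨c, hc⟩ := Ideal.exists_pow_inf_eq_pow_smul I Z
  have hJ : J • Z ≤ LinearMap.range (koszulD N (fun j => x j ^ n) (i + 1)) := by
    rw [Submodule.span_smul_eq, Submodule.set_smul_le_iff]
    rintro _ z ⟨j, rfl⟩ hz
    exact smul_mem_range_koszulD (fun j => x j ^ n) j hz
  refine ⟨n + (a + c), fun m hm => ⟨by omega, fun z hz => hJ ?_⟩⟩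
  have hmem : koszulTrans N x m n (i + 1) z ∈ I ^ (m - n) • ⊤ ⊓ Z := by
    refine ⟨koszulTrans_mem_pow_smul_top x m n z, LinearMap.mem_ker.2 ?_⟩
    rw [koszulD_koszulTrans x (by omega), LinearMap.mem_ker.1 hz, map_zero]
  rw [hc _ (by omega)] at hmem
  exact Submodule.smul_mono ((Ideal.pow_le_pow_right (by omega)).trans ha) inf_le_right hmem

theorem isWeaklyProregular_of_isNoetherianRing [IsNoetherianRing R] [Module.Finite R N]
    (x : Fin l → R) : IsWeaklyProregular N x := by
  intro n
  choose m₀ hm₀ using exists_forall_koszulTrans_mem_range (N := N) x n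
  refine ⟨n + (Finset.range l).sup m₀, by omega, fun i z hz => ?_⟩
  by_cases hi : i < l
  · exact (hm₀ i _ ((Finset.le_sup (Finset.mem_range.2 hi)).trans (by omega))).2 z hz
  · have : IsEmpty {s : Finset (Fin l) // s.card = i + 1} :=
      ⟨fun s => by have := s.1.card_le_univ; rw [s.2, Fintype.card_fin] at this; omega⟩
    rw [Subsingleton.elim (koszulTrans N x _ n (i + 1) z) 0]
    exact zero_mem _

end Koszul

lemma isParameterSeq_iff {R : Type*} [CommRing R] [IsNoetherianRing R] {N : Type*} [AddCommGroup N]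
    [Module R N] [Module.Finite R N] (rs : List R) :
    IsParameterSeq R N rs ↔ Ideal.ofList rs • (⊤ : Submodule R N) ≠ ⊤ ∧
      ∀ p ∈ Module.support R (N ⧸ (Ideal.ofList rs • ⊤ : Submodule R N)),
        TopNonzeroAt N rs p.asIdeal := by
  simp_rw [← nontrivial_localizedModule_topCech_iff]
  exact ⟨fun h => ⟨h.2, h.3⟩, fun h => ⟨isWeaklyProregular_of_isNoetherianRing _, h.1, h.2⟩⟩

section RegularSequence

variable {R : Type*} [CommRing R] {N : Type*} [AddCommGroup N] [Module R N]

lemma mem_smul_top_sup_iff (r : R) (L : Submodule R N) (n : N) :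
    n ∈ r • (⊤ : Submodule R N) ⊔ L ↔ ∃ k, n - r • k ∈ L := by
  rw [Submodule.mem_sup]
  constructor
  · rintro ⟨_, ⟨k, -, rfl⟩, z, hz, rfl⟩
    exact ⟨k, (add_sub_cancel_left (r • k) z).symm ▸ hz⟩
  · rintro ⟨k, hk⟩
    exact ⟨r • k, Submodule.smul_mem_pointwise_smul _ _ _ trivial, _, hk, add_sub_cancel _ _⟩

lemma mem_ofList_cons_smul_top_iff (r : R) (rs : List R) (n : N) :
    n ∈ (Ideal.ofList (r :: rs) • ⊤ : Submodule R N) ↔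
      ∃ k, n - r • k ∈ (Ideal.ofList rs • ⊤ : Submodule R N) := by
  rw [Ideal.ofList_cons_smul, mem_smul_top_sup_iff]

lemma mk_mem_smul_top_iff (L : Submodule R N) (J : Ideal R) (n : N) :
    (Submodule.Quotient.mk n : N ⧸ L) ∈ (J • ⊤ : Submodule R (N ⧸ L)) ↔
      n ∈ L ⊔ (J • ⊤ : Submodule R N) := by
  have h : (J • ⊤ : Submodule R (N ⧸ L)) = (J • ⊤ : Submodule R N).map L.mkQ := by
    rw [Submodule.map_smul'', Submodule.map_top, Submodule.range_mkQ]
  rw [h, ← Submodule.mkQ_apply, ← Submodule.mem_comap, Submodule.comap_map_eq,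
    Submodule.ker_mkQ, sup_comm]

lemma mk_quotSMulTop_mem_iff (r : R) (J : Ideal R) (n : N) :
    (Submodule.Quotient.mk n : QuotSMulTop r N) ∈ (J • ⊤ : Submodule R (QuotSMulTop r N)) ↔
      ∃ k, n - r • k ∈ (J • ⊤ : Submodule R N) := by
  rw [mk_mem_smul_top_iff, mem_smul_top_sup_iff]

lemma mk_quotSMulTop_eq_zero_iff (r : R) (n : N) :
    (Submodule.Quotient.mk n : QuotSMulTop r N) = 0 ↔ ∃ k, r • k = n := by
  simp only [Submodule.Quotient.mk_eq_zero, Submodule.mem_smul_pointwise_iff_exists,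
    Submodule.mem_top, true_and]

theorem isWeaklyRegular_of_exact {A B C : Type*} [AddCommGroup A] [Module R A] [AddCommGroup B]
    [Module R B] [AddCommGroup C] [Module R C] {f : A →ₗ[R] B} {g : B →ₗ[R] C}
    (hf : Function.Injective f) (hfg : Function.Exact f g) (hg : Function.Surjective g)
    {rs : List R} (hA : IsWeaklyRegular A rs) (hC : IsWeaklyRegular C rs) :
    IsWeaklyRegular B rs := by
  induction rs generalizing A B C with
  | nil => exact .nil R B
  | cons r rs ih =>
    rw [isWeaklyRegular_cons_iff] at hA hC ⊢
    have hf' : Function.Injective (QuotSMulTop.map r f) := by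
      rw [← LinearMap.exact_zero_iff_injective (QuotSMulTop r A), ← map_zero (QuotSMulTop.map r)]
      exact QuotSMulTop.map_first_exact_on_four_term_exact_of_isSMulRegular_last
        ((LinearMap.exact_zero_iff_injective A f).2 hf) hfg hC.1
    exact ⟨isSMulRegular_of_range_eq_ker hf (LinearMap.exact_iff.1 hfg).symm hA.1 hC.1,
      ih hf' (QuotSMulTop.map_exact r hfg hg) (QuotSMulTop.map_surjective r hg) hA.2 hC.2⟩

theorem isWeaklyRegular_of_leftInverse {A B : Type*} [AddCommGroup A] [Module R A] [AddCommGroup B]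
    [Module R B] {f : A →ₗ[R] B} {g : B →ₗ[R] A} (hgf : Function.LeftInverse g f)
    {rs : List R} (hB : IsWeaklyRegular B rs) : IsWeaklyRegular A rs := by
  induction rs generalizing A B with
  | nil => exact .nil R A
  | cons r rs ih =>
    rw [isWeaklyRegular_cons_iff] at hB ⊢
    have hgf' : Function.LeftInverse (QuotSMulTop.map r g) (QuotSMulTop.map r f) := by
      intro a
      obtain ⟨a, rfl⟩ := Submodule.mkQ_surjective _ a
      exact congrArg Submodule.Quotient.mk (hgf a)
    exact ⟨hB.1.of_injective f hgf.injective, ih hgf' hB.2⟩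

variable (N) in
/-- The map `N / bN → N / (ab)N` induced by multiplication by `a`. -/
def quotSMulTopMulLeft (a b : R) : QuotSMulTop b N →ₗ[R] QuotSMulTop (a * b) N :=
  Submodule.mapQ _ _ (LinearMap.lsmul R N a) (by
    rintro _ ⟨k, -, rfl⟩
    exact ⟨k, trivial, mul_smul a b k⟩)

variable (N) in
/-- The projection `N / (ab)N → N / aN`. -/
def quotSMulTopMulProj (a b : R) : QuotSMulTop (a * b) N →ₗ[R] QuotSMulTop a N :=
  Submodule.factor (by
    rintro _ ⟨k, -, rfl⟩
    exact ⟨b • k, trivial, (mul_smul a b k).symm⟩)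

lemma quotSMulTopMulLeft_injective {a : R} (ha : IsSMulRegular N a) (b : R) :
    Function.Injective (quotSMulTopMulLeft N a b) := by
  rw [injective_iff_map_eq_zero]
  intro n hn
  obtain ⟨n, rfl⟩ := Submodule.mkQ_surjective _ n
  obtain ⟨k, hk⟩ := (mk_quotSMulTop_eq_zero_iff (a * b) (a • n)).1 hn
  exact (mk_quotSMulTop_eq_zero_iff b n).2 ⟨k, ha ((mul_smul a b k).symm.trans hk)⟩

lemma exact_quotSMulTopMulLeft_quotSMulTopMulProj (a b : R) :
    Function.Exact (quotSMulTopMulLeft N a b) (quotSMulTopMulProj N a b) := by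
  intro n
  obtain ⟨n, rfl⟩ := Submodule.mkQ_surjective _ n
  constructor
  · intro hn
    obtain ⟨k, rfl⟩ := (mk_quotSMulTop_eq_zero_iff a n).1 hn
    exact ⟨Submodule.Quotient.mk k, rfl⟩
  · rintro ⟨k, hk⟩
    obtain ⟨k, rfl⟩ := Submodule.mkQ_surjective _ k
    rw [← hk]
    exact (mk_quotSMulTop_eq_zero_iff a (a • k)).2 ⟨k, rfl⟩

lemma quotSMulTopMulProj_surjective (a b : R) :
    Function.Surjective (quotSMulTopMulProj N a b) := by
  intro n
  obtain ⟨n, rfl⟩ := Submodule.mkQ_surjective _ n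
  exact ⟨Submodule.Quotient.mk n, rfl⟩

lemma isWeaklyRegular_mul_cons {a b : R} {rs : List R} (ha : IsWeaklyRegular N (a :: rs))
    (hb : IsWeaklyRegular N (b :: rs)) : IsWeaklyRegular N (a * b :: rs) := by
  rw [isWeaklyRegular_cons_iff] at ha hb ⊢
  exact ⟨ha.1.mul hb.1, isWeaklyRegular_of_exact (quotSMulTopMulLeft_injective ha.1 b)
    (exact_quotSMulTopMulLeft_quotSMulTopMulProj a b) (quotSMulTopMulProj_surjective a b) hb.2
    ha.2⟩

lemma isWeaklyRegular_pow_cons {r : R} {rs : List R} (h : IsWeaklyRegular N (r :: rs)) (a : ℕ) :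
    IsWeaklyRegular N (r ^ (a + 1) :: rs) := by
  induction a with
  | zero => rwa [zero_add, pow_one]
  | succ a ih => exact pow_succ' r (a + 1) ▸ isWeaklyRegular_mul_cons h ih

lemma isWeaklyRegular_map_pow {rs : List R} (h : IsWeaklyRegular N rs) (a : ℕ) :
    IsWeaklyRegular N (rs.map (· ^ (a + 1))) := by
  induction rs generalizing N with
  | nil => exact .nil R N
  | cons r rs ih =>
    have h' := isWeaklyRegular_pow_cons h a
    rw [List.map_cons, isWeaklyRegular_cons_iff] at *
    exact ⟨h'.1, ih h'.2⟩

lemma isRegular_take {rs : List R} (h : IsRegular N rs) (i : ℕ) : IsRegular N (rs.take i) := by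
  refine ⟨?_, fun htop => h.top_ne_smul (le_antisymm ?_ le_top)⟩
  · have := h.toIsWeaklyRegular
    rw [← List.take_append_drop i rs, isWeaklyRegular_append_iff] at this
    exact this.1
  · conv_lhs => rw [htop]
    exact Submodule.smul_mono_left (Ideal.span_mono fun a ha => List.mem_of_mem_take ha)

end RegularSequence

section IsLocalRing

open IsLocalRing

variable {R : Type*} [CommRing R] [IsLocalRing R] {N : Type*} [AddCommGroup N] [Module R N]

lemma mem_maximalIdeal_of_ofList_smul_ne_top {rs : List R}
    (h : Ideal.ofList rs • (⊤ : Submodule R N) ≠ ⊤) : ∀ r ∈ rs, r ∈ maximalIdeal R := by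
  intro r hr
  refine le_maximalIdeal (J := Ideal.ofList rs) (fun h' => h ?_) (Ideal.subset_span hr)
  rw [h', Submodule.top_smul]

variable [IsNoetherian R N]

lemma isSMulRegular_quotient_map_pow {r : R} {rs : List R}
    (hm : ∀ a ∈ r :: rs, a ∈ maximalIdeal R) (h : IsWeaklyRegular N (r :: rs)) (a : ℕ) :
    IsSMulRegular (N ⧸ (Ideal.ofList (rs.map (· ^ (a + 1))) • ⊤ : Submodule R N)) r := by
  have hmap : IsWeaklyRegular N (r :: rs.map (· ^ (a + 1))) := by
    rw [isWeaklyRegular_cons_iff] at h ⊢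
    exact ⟨h.1, isWeaklyRegular_map_pow h.2 a⟩
  have hperm : IsWeaklyRegular N (rs.map (· ^ (a + 1)) ++ [r]) := by
    refine isWeaklyRegular_of_perm_of_subset_maximalIdeal hmap
      (List.perm_append_singleton r _).symm fun b hb => ?_
    rcases List.mem_cons.1 hb with rfl | hb
    · exact hm _ List.mem_cons_self
    · obtain ⟨c, hc, rfl⟩ := List.mem_map.1 hb
      exact Ideal.pow_mem_of_mem _ (hm c (List.mem_cons_of_mem _ hc)) _ (Nat.succ_pos a)
  rw [isWeaklyRegular_append_iff, isWeaklyRegular_singleton_iff] at hperm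
  exact hperm.2

/-- The maps `N / (x ^ t)N → H_x(N)` are injective for a regular sequence. -/
lemma mem_of_prod_pow_smul_mem {rs : List R} (hm : ∀ a ∈ rs, a ∈ maximalIdeal R)
    (h : IsWeaklyRegular N rs) (t u : ℕ) {n : N}
    (hn : rs.prod ^ u • n ∈ (Ideal.ofList (rs.map (· ^ (t + 1 + u))) • ⊤ : Submodule R N)) :
    n ∈ (Ideal.ofList (rs.map (· ^ (t + 1))) • ⊤ : Submodule R N) := by
  induction rs generalizing N with
  | nil => simpa using hn
  | cons r rs ih =>
    rw [List.map_cons, mem_ofList_cons_smul_top_iff] at hn ⊢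
    obtain ⟨k, hk⟩ := hn
    rw [← mk_quotSMulTop_mem_iff]
    refine ih (fun a ha => hm a (List.mem_cons_of_mem _ ha))
      ((isWeaklyRegular_cons_iff _ _ _).1 (isWeaklyRegular_pow_cons h t)).2 ?_
    rw [← Submodule.Quotient.mk_smul, mk_quotSMulTop_mem_iff]
    have hr : IsSMulRegular (N ⧸ (Ideal.ofList (rs.map (· ^ (t + 1 + u))) • ⊤ : Submodule R N)) r :=
      (show t + 1 + u = t + u + 1 by ring) ▸ isSMulRegular_quotient_map_pow hm h (t + u)
    refine ⟨k, mem_of_isSMulRegular_quotient_of_smul_mem (hr.pow u) ?_⟩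
    convert hk using 1
    rw [List.prod_cons, smul_sub, smul_smul, smul_smul, ← mul_pow, ← pow_add, add_comm u]

lemma exists_sub_prod_pow_smul_mem {rs : List R} (hm : ∀ a ∈ rs, a ∈ maximalIdeal R)
    (h : IsWeaklyRegular N rs) (t : ℕ) {n : N}
    (hn : ∀ r ∈ rs, r • n ∈ (Ideal.ofList (rs.map (· ^ (t + 1))) • ⊤ : Submodule R N)) :
    ∃ n', n - rs.prod ^ t • n' ∈ (Ideal.ofList (rs.map (· ^ (t + 1))) • ⊤ : Submodule R N) := by
  induction rs generalizing N with
  | nil => exact ⟨n, by simp⟩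
  | cons r rs ih =>
    have hr := isSMulRegular_quotient_map_pow hm h t
    obtain ⟨k, hk⟩ : ∃ k, n - r ^ t • k ∈
        (Ideal.ofList (rs.map (· ^ (t + 1))) • ⊤ : Submodule R N) := by
      obtain ⟨k, hk⟩ := (mem_ofList_cons_smul_top_iff _ _ _).1 (hn r List.mem_cons_self)
      refine ⟨k, mem_of_isSMulRegular_quotient_of_smul_mem hr ?_⟩
      rwa [smul_sub, smul_smul, ← pow_succ']
    have hkill : ∀ s ∈ rs, s • (Submodule.Quotient.mk k : QuotSMulTop r N) ∈
        (Ideal.ofList (rs.map (· ^ (t + 1))) • ⊤ : Submodule R (QuotSMulTop r N)) := by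
      intro s hs
      obtain ⟨j, hj⟩ := (mem_ofList_cons_smul_top_iff _ _ _).1 (hn s (List.mem_cons_of_mem _ hs))
      rw [← Submodule.Quotient.mk_smul, mk_quotSMulTop_mem_iff]
      refine ⟨j, mem_of_isSMulRegular_quotient_of_smul_mem (hr.pow t) ?_⟩
      convert sub_mem hj (Submodule.smul_mem _ s hk) using 1
      module
    obtain ⟨k', hk'⟩ := ih (fun a ha => hm a (List.mem_cons_of_mem _ ha))
      ((isWeaklyRegular_cons_iff _ _ _).1 h).2 hkill
    obtain ⟨k', rfl⟩ := Submodule.mkQ_surjective _ k'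
    rw [Submodule.mkQ_apply, ← Submodule.Quotient.mk_smul, ← Submodule.Quotient.mk_sub,
      mk_quotSMulTop_mem_iff] at hk'
    obtain ⟨j, hj⟩ := hk'
    refine ⟨k', (mem_ofList_cons_smul_top_iff _ _ _).2 ⟨j, ?_⟩⟩
    convert add_mem hk (Submodule.smul_mem _ (r ^ t) hj) using 1
    rw [List.prod_cons, mul_pow]
    module

lemma topNonzeroAt_of_isWeaklyRegular {rs : List R} (hm : ∀ a ∈ rs, a ∈ maximalIdeal R)
    (h : IsWeaklyRegular N rs) {p : PrimeSpectrum R}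
    (hp : p ∈ Module.support R (N ⧸ (Ideal.ofList rs • ⊤ : Submodule R N))) :
    TopNonzeroAt N rs p.asIdeal := by
  rw [Module.mem_support_iff'] at hp
  obtain ⟨m, hpm⟩ := hp
  obtain ⟨m, rfl⟩ := Submodule.mkQ_surjective _ m
  refine ⟨1, m, fun s hs u hu => hpm s hs ?_⟩
  rw [smul_comm] at hu
  have hsm := mem_of_prod_pow_smul_mem hm h 0 u (by rwa [zero_add])
  rw [← map_smul, Submodule.mkQ_apply, Submodule.Quotient.mk_eq_zero]
  simpa only [zero_add, pow_one, List.map_id'] using hsm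

end IsLocalRing

section ParameterSeq

variable {R : Type*} [CommRing R] [IsLocalRing R] [IsNoetherianRing R]
  {N : Type*} [AddCommGroup N] [Module R N] [Module.Finite R N]

theorem isParameterSeq_of_isRegular {rs : List R} (h : IsRegular N rs) :
    IsParameterSeq R N rs := by
  have hne : Ideal.ofList rs • (⊤ : Submodule R N) ≠ ⊤ := h.top_ne_smul.symm
  exact (isParameterSeq_iff rs).2 ⟨hne, fun p hp => topNonzeroAt_of_isWeaklyRegular
    (mem_maximalIdeal_of_ofList_smul_ne_top hne) h.toIsWeaklyRegular hp⟩

theorem isStrongParameterSeq_of_isRegular {rs : List R} (h : IsRegular N rs) :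
    IsStrongParameterSeq R N rs :=
  fun i _ _ => isParameterSeq_of_isRegular (isRegular_take h i)

end ParameterSeq

section FiniteSocle

universe u

variable {R : Type*} [CommRing R]

section Artinian

variable {T : Type*} [AddCommGroup T] [Module R T]

/-- The part of `r ^ n • B` killed by `r`. The chain of these submodules, `n = 0, 1, …`, determines
`B` inside a larger submodule of an `r`-power torsion module. -/
def leadingPart (r : R) (n : ℕ) (B : Submodule R T) : Submodule R (Submodule.torsionBy R T r) :=
  (B.map (LinearMap.lsmul R T (r ^ n))).comap (Submodule.subtype _)

lemma mem_leadingPart {r : R} {n : ℕ} {B : Submodule R T} {a : Submodule.torsionBy R T r} :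
    a ∈ leadingPart r n B ↔ ∃ b ∈ B, r ^ n • b = a := Iff.rfl

lemma leadingPart_mono (r : R) {m n : ℕ} (hmn : m ≤ n) {B B' : Submodule R T} (hB : B ≤ B') :
    leadingPart r n B ≤ leadingPart r m B' := by
  rintro a ⟨b, hb, h⟩
  refine ⟨r ^ (n - m) • b, B'.smul_mem _ (hB hb), ?_⟩
  rw [← h, LinearMap.lsmul_apply, LinearMap.lsmul_apply, smul_smul, ← pow_add,
    Nat.add_sub_of_le hmn]

lemma le_of_leadingPart_le {r : R} (hr : ∀ t : T, ∃ n : ℕ, r ^ n • t = 0) {B B' : Submodule R T}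
    (hB : B ≤ B') (h : ∀ n, leadingPart r n B' ≤ leadingPart r n B) : B' ≤ B := by
  suffices ∀ n, ∀ b ∈ B', r ^ n • b = 0 → b ∈ B by
    intro b hb
    obtain ⟨n, hn⟩ := hr b
    exact this n b hb hn
  intro n
  induction n with
  | zero =>
    intro b _ h0
    rw [pow_zero, one_smul] at h0
    exact h0 ▸ zero_mem B
  | succ n ih =>
    intro b hb h0
    have hb' : r ^ n • b ∈ Submodule.torsionBy R T r := by
      rw [Submodule.mem_torsionBy_iff, smul_smul, ← pow_succ', h0]
    obtain ⟨c, hc, hcb⟩ : ∃ c ∈ B, r ^ n • c = r ^ n • b :=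
      mem_leadingPart.1 (@h n ⟨_, hb'⟩ (mem_leadingPart.2 ⟨b, hb, rfl⟩))
    have hbc := ih (b - c) (sub_mem hb (hB hc)) (by rw [smul_sub, hcb, sub_self])
    exact (Submodule.sub_mem_iff_left B hc).1 hbc

theorem isArtinian_of_isArtinian_torsionBy {r : R} (hr : ∀ t : T, ∃ n : ℕ, r ^ n • t = 0)
    [IsArtinian R (Submodule.torsionBy R T r)] : IsArtinian R T := by
  rw [← monotone_stabilizes_iff_artinian]
  intro f
  let B (i : ℕ) : Submodule R T := OrderDual.ofDual (f i)
  have hB {i j : ℕ} (h : i ≤ j) : B j ≤ B i := f.monotone h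
  have hstab := monotone_stabilizes_iff_artinian (R := R) (M := Submodule.torsionBy R T r).2 ‹_›
  obtain ⟨a, ha⟩ : ∃ a, ∀ m ≥ a, leadingPart r a (B a) = leadingPart r m (B m) :=
    hstab ⟨fun i => OrderDual.toDual (leadingPart r i (B i)),
      fun i j h => leadingPart_mono r h (hB h)⟩
  have hrow (n : ℕ) : ∃ k, ∀ m ≥ k, leadingPart r n (B k) = leadingPart r n (B m) :=
    hstab ⟨fun i => OrderDual.toDual (leadingPart r n (B i)),
      fun i j h => leadingPart_mono r le_rfl (hB h)⟩
  choose k hk using hrow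
  refine ⟨a + (Finset.range a).sup k, fun m hm => ?_⟩
  refine le_antisymm (f.monotone hm) (le_of_leadingPart_le hr (hB hm) fun n => ?_)
  change leadingPart r n (B _) ≤ leadingPart r n (B m)
  by_cases hn : n < a
  · have hkn : k n ≤ (Finset.range a).sup k := Finset.le_sup (Finset.mem_range.2 hn)
    rw [← hk n (a + (Finset.range a).sup k) (by omega), ← hk n m (by omega)]
  · calc leadingPart r n (B (a + (Finset.range a).sup k))
      _ ≤ leadingPart r a (B a) := leadingPart_mono r (by omega) (hB (by omega))
      _ = leadingPart r (max n m) (B (max n m)) := ha _ (by omega)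
      _ ≤ leadingPart r n (B m) := leadingPart_mono r (by omega) (hB (by omega))

lemma exists_eq_add_smul_of_isArtinian [IsArtinian R T] (r : R) :
    ∃ n, ∀ t : T, ∃ a b, r ^ n • a = 0 ∧ t = a + r • b := by
  obtain ⟨n, hn⟩ := Filter.eventually_atTop.1
    (LinearMap.eventually_codisjoint_ker_pow_range_pow (algebraMap R (Module.End R T) r))
  refine ⟨n + 1, fun t => ?_⟩
  obtain ⟨a, ha, _, ⟨c, rfl⟩, h⟩ := Submodule.mem_sup.1
    ((hn (n + 1) n.le_succ).eq_top ▸ Submodule.mem_top : t ∈ _)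
  rw [← map_pow, Module.algebraMap_end_apply] at h
  rw [← map_pow, LinearMap.mem_ker, Module.algebraMap_end_apply] at ha
  exact ⟨a, r ^ n • c, ha, by rw [smul_smul, ← pow_succ', h]⟩

end Artinian

section KilledBy

variable {T : Type*} [AddCommGroup T] [Module R T] {U : Type*} [AddCommGroup U] [Module R U]

variable (T) in
/-- The submodule of elements killed by all members of a list: `Hom(R / (rs), T)`. -/
def killedBy (rs : List R) : Submodule R T :=
  Submodule.torsionBySet R T {r | r ∈ rs}

lemma mem_killedBy {rs : List R} {t : T} : t ∈ killedBy T rs ↔ ∀ r ∈ rs, r • t = 0 :=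
  (Submodule.mem_torsionBySet_iff _ _).trans Subtype.forall

lemma mem_killedBy_cons {r : R} {rs : List R} {t : T} :
    t ∈ killedBy T (r :: rs) ↔ r • t = 0 ∧ t ∈ killedBy T rs := by
  simp only [mem_killedBy, List.forall_mem_cons]

/-- `killedBy` is a functor. -/
def killedByMap (f : T →ₗ[R] U) (rs : List R) : killedBy T rs →ₗ[R] killedBy U rs :=
  f.restrict fun t ht => mem_killedBy.2 fun r hr => by
    rw [← map_smul, mem_killedBy.1 ht r hr, map_zero]

lemma killedByMap_injective {f : T →ₗ[R] U} (hf : Function.Injective f) (rs : List R) :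
    Function.Injective (killedByMap f rs) :=
  fun _ _ h => Subtype.ext (hf (congrArg Subtype.val h))

lemma isNoetherian_killedBy_of_injective {f : T →ₗ[R] U} (hf : Function.Injective f) (rs : List R)
    [IsNoetherian R (killedBy U rs)] : IsNoetherian R (killedBy T rs) :=
  isNoetherian_of_injective _ (killedByMap_injective hf rs)

lemma range_killedByMap_eq_ker {V : Type*} [AddCommGroup V] [Module R V] {f : T →ₗ[R] U}
    {g : U →ₗ[R] V} (hf : Function.Injective f) (hfg : Function.Exact f g) (rs : List R) :
    LinearMap.range (killedByMap f rs) = LinearMap.ker (killedByMap g rs) := by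
  ext u
  constructor
  · rintro ⟨t, rfl⟩
    exact Subtype.ext (hfg.apply_apply_eq_zero t)
  · intro hu
    obtain ⟨t, ht⟩ := (hfg u).1 (congrArg Subtype.val hu)
    refine ⟨⟨t, mem_killedBy.2 fun r hr => hf ?_⟩, Subtype.ext ht⟩
    rw [map_smul, ht, mem_killedBy.1 u.2 r hr, map_zero]

variable (T) in
lemma killedBy_torsionBy_map_subtype (r : R) (rs : List R) :
    (killedBy (Submodule.torsionBy R T r) rs).map (Submodule.subtype _) =
      killedBy T (r :: rs) := by
  ext t
  rw [mem_killedBy_cons]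
  constructor
  · rintro ⟨t, ht, rfl⟩
    exact ⟨t.2, mem_killedBy.2 fun s hs => congrArg Subtype.val (mem_killedBy.1 ht s hs)⟩
  · rintro ⟨hrt, ht⟩
    exact ⟨⟨t, hrt⟩, mem_killedBy.2 fun s hs => Subtype.ext (mem_killedBy.1 ht s hs), rfl⟩

variable (T) in
/-- An element killed by `r :: rs` is an element of the `r`-torsion killed by `rs`. -/
def killedByTorsionByEquiv (r : R) (rs : List R) :
    killedBy (Submodule.torsionBy R T r) rs ≃ₗ[R] killedBy T (r :: rs) :=
  (Submodule.equivMapOfInjective _ (Submodule.subtype_injective _) _).trans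
    (LinearEquiv.ofEq _ _ (killedBy_torsionBy_map_subtype T r rs))

theorem isArtinian_of_isArtinian_killedBy {rs : List R}
    (htor : ∀ r ∈ rs, ∀ t : T, ∃ n : ℕ, r ^ n • t = 0) [IsArtinian R (killedBy T rs)] :
    IsArtinian R T := by
  induction rs generalizing T with
  | nil =>
    have htop : killedBy T ([] : List R) = ⊤ :=
      eq_top_iff.2 fun t _ => mem_killedBy.2 fun r hr => absurd hr List.not_mem_nil
    exact isArtinian_of_linearEquiv ((LinearEquiv.ofEq _ _ htop).trans Submodule.topEquiv)
  | cons r rs ih =>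
    rw [List.forall_mem_cons] at htor
    have := isArtinian_of_linearEquiv (killedByTorsionByEquiv T r rs).symm
    have : IsArtinian R (Submodule.torsionBy R T r) := ih fun s hs t => by
      obtain ⟨n, hn⟩ := htor.2 s hs t
      exact ⟨n, Subtype.ext hn⟩
    exact isArtinian_of_isArtinian_torsionBy htor.1

variable (T) in
lemma isNoetherian_killedBy_pow_cons (r : R) (rs : List R)
    [IsNoetherian R (killedBy T (r :: rs))] (n : ℕ) :
    IsNoetherian R (killedBy T (r ^ n :: rs)) := by
  induction n with
  | zero =>
    have : Subsingleton (killedBy T (r ^ 0 :: rs)) := by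
      rw [Submodule.subsingleton_iff_eq_bot, eq_bot_iff]
      intro t ht
      simpa only [pow_zero, one_smul, Submodule.mem_bot] using (mem_killedBy_cons.1 ht).1
    infer_instance
  | succ n ih =>
    have hle : killedBy T (r ^ n :: rs) ≤ killedBy T (r ^ (n + 1) :: rs) := fun t ht => by
      rw [mem_killedBy_cons] at ht ⊢
      exact ⟨by rw [pow_succ', mul_smul, ht.1, smul_zero], ht.2⟩
    let g : killedBy T (r ^ (n + 1) :: rs) →ₗ[R] killedBy T (r :: rs) :=
      (LinearMap.lsmul R T (r ^ n)).restrict fun t ht => by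
        rw [mem_killedBy_cons] at ht ⊢
        exact ⟨by rw [LinearMap.lsmul_apply, smul_smul, ← pow_succ', ht.1],
          Submodule.smul_mem _ _ ht.2⟩
    refine isNoetherian_of_range_eq_ker (Submodule.inclusion hle) g ?_
    rw [Submodule.range_inclusion]
    ext ⟨t, ht⟩
    rw [LinearMap.mem_ker, Submodule.mem_comap, mem_killedBy_cons]
    exact ⟨fun h => Subtype.ext h.1, fun h => ⟨congrArg Subtype.val h, (mem_killedBy_cons.1 ht).2⟩⟩

end KilledBy

section SnakeLemma

variable {B : Type*} [AddCommGroup B] [Module R B] {C : Type*} [AddCommGroup C] [Module R C]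

/-- The map induced by a linear map on `r`-torsion. -/
def torsionByMap (g : B →ₗ[R] C) (r : R) :
    Submodule.torsionBy R B r →ₗ[R] Submodule.torsionBy R C r :=
  g.restrict fun b hb => by
    rw [Submodule.mem_torsionBy_iff] at hb ⊢
    rw [← map_smul, hb, map_zero]

lemma exact_torsionBy_subtype_lsmul (r : R) :
    Function.Exact (Submodule.torsionBy R B r).subtype (LinearMap.lsmul R B r) := fun b =>
  ⟨fun hb => ⟨⟨b, hb⟩, rfl⟩, by rintro ⟨b, rfl⟩; exact b.2⟩

lemma isArtinian_ker_torsionByMap_rangeRestrict (g : B →ₗ[R] C) [IsArtinian R (LinearMap.ker g)]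
    (r : R) : IsArtinian R (LinearMap.ker (torsionByMap g r).rangeRestrict) := by
  let f : LinearMap.ker (torsionByMap g r).rangeRestrict →ₗ[R] LinearMap.ker g :=
    ((Submodule.torsionBy R B r).subtype ∘ₗ Submodule.subtype _).codRestrict _ fun b =>
      congrArg Subtype.val (congrArg Subtype.val (LinearMap.mem_ker.1 b.2))
  exact isArtinian_of_injective f fun a b hab =>
    Subtype.ext (Subtype.ext (congrArg (LinearMap.ker g).subtype hab))

lemma exists_exact_torsionByMap {g : B →ₗ[R] C} (hg : Function.Surjective g) (r : R) :
    ∃ δ : Submodule.torsionBy R C r →ₗ[R] QuotSMulTop r (LinearMap.ker g),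
      Function.Exact (torsionByMap g r) δ :=
  ⟨_, SnakeLemma.exact_δ'_right (LinearMap.lsmul R (LinearMap.ker g) r) (LinearMap.lsmul R B r)
    (LinearMap.lsmul R C r) (LinearMap.ker g).subtype g (LinearMap.exact_subtype_ker_map g)
    (LinearMap.ker g).subtype g (LinearMap.exact_subtype_ker_map g) rfl
    (LinearMap.ext fun b => (map_smul g r b)) _ (exact_torsionBy_subtype_lsmul r) _
    (exact_torsionBy_subtype_lsmul r) (Submodule.mkQ _)
    (fun a => mk_quotSMulTop_eq_zero_iff r a) hg
    (Submodule.subtype_injective _) (torsionByMap g r) rfl (Submodule.subtype_injective _)⟩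

end SnakeLemma

/-- The induction uses the snake lemma sequence `B[r] → C[r] → ker g / r ker g`, whose last term is
a quotient of the Artinian module of elements of `ker g` killed by a power of `r`. -/
theorem isNoetherian_killedBy_of_surjective (rs : List R) {B C : Type u} [AddCommGroup B]
    [Module R B] [AddCommGroup C] [Module R C] {g : B →ₗ[R] C} (hg : Function.Surjective g)
    [IsArtinian R (LinearMap.ker g)] [IsNoetherian R (killedBy B rs)] :
    IsNoetherian R (killedBy C rs) := by
  induction rs generalizing B C with
  | nil =>
    have hsurj : Function.Surjective (killedByMap g []) := by
      rintro ⟨c, _⟩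
      obtain ⟨b, rfl⟩ := hg c
      exact ⟨⟨b, mem_killedBy.2 fun r hr => absurd hr List.not_mem_nil⟩, rfl⟩
    exact isNoetherian_of_surjective _ (LinearMap.range_eq_top.2 hsurj)
  | cons r rs ih =>
    have hquot : IsNoetherian R (killedBy (QuotSMulTop r (LinearMap.ker g)) rs) := by
      obtain ⟨n, hn⟩ := exists_eq_add_smul_of_isArtinian (T := LinearMap.ker g) r
      let U := Submodule.torsionBy R (LinearMap.ker g) (r ^ n)
      have := isNoetherian_killedBy_of_injective (LinearMap.ker g).subtype_injective (r :: rs)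
      have := isNoetherian_killedBy_pow_cons (LinearMap.ker g) r rs n
      have := isNoetherian_of_linearEquiv
        (killedByTorsionByEquiv (LinearMap.ker g) (r ^ n) rs).symm
      refine ih (B := U) (g := Submodule.mkQ _ ∘ₗ U.subtype) fun c => ?_
      obtain ⟨t, rfl⟩ := Submodule.mkQ_surjective _ c
      obtain ⟨a, b, ha, rfl⟩ := hn t
      refine ⟨⟨a, (Submodule.mem_torsionBy_iff _ _).2 ha⟩, ?_⟩
      rw [map_add, Submodule.mkQ_apply _ (r • b), (mk_quotSMulTop_eq_zero_iff r (r • b)).2 ⟨b, rfl⟩,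
        add_zero]
      rfl
    obtain ⟨δ, hδ⟩ := exists_exact_torsionByMap hg r
    have hker : IsNoetherian R (killedBy (LinearMap.range (torsionByMap g r)) rs) := by
      have := isNoetherian_of_linearEquiv (killedByTorsionByEquiv B r rs).symm
      have := isArtinian_ker_torsionByMap_rangeRestrict g r
      exact ih (torsionByMap g r).surjective_rangeRestrict
    have := isNoetherian_of_range_eq_ker _ _ (range_killedByMap_eq_ker
      (Submodule.subtype_injective _) (hδ.linearMap_ker_eq ▸ LinearMap.exact_subtype_ker_map δ) rs)
    exact isNoetherian_of_linearEquiv (killedByTorsionByEquiv C r rs)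

end FiniteSocle

lemma isArtinian_of_isTorsionBySet {R V : Type*} [CommRing R] [AddCommGroup V] [Module R V]
    [Module.Finite R V] {J : Ideal R} [IsArtinianRing (R ⧸ J)]
    (hJ : Module.IsTorsionBySet R V J) : IsArtinian R V := by
  let := hJ.module
  have : IsScalarTower R (R ⧸ J) V := hJ.isScalarTower
  have : Module.Finite (R ⧸ J) V := Module.Finite.of_restrictScalars_finite R (R ⧸ J) V
  exact isArtinian_of_surjective_algebraMap (Ideal.Quotient.mk_surjective (I := J))

section Nonvanishing

open IsLocalRing

section TopCech

variable {R : Type*} [CommRing R] {N : Type*} [AddCommGroup N] [Module R N]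

lemma cechClass_eq_zero_of_mem {rs : List R} {t : ℕ} {n : N}
    (hn : n ∈ (Ideal.ofList (rs.map (· ^ t)) • ⊤ : Submodule R N)) :
    cechClass N rs.get t n = 0 :=
  (cechClass_get_eq_zero_iff rs t n).2 ⟨0, by simpa only [pow_zero, one_smul, add_zero] using hn⟩

lemma pow_smul_cechClass_of_mem {rs : List R} {r : R} (hr : r ∈ rs) (t : ℕ) (n : N) :
    r ^ t • cechClass N rs.get t n = 0 := by
  rw [← map_smul]
  exact cechClass_eq_zero_of_mem
    (Submodule.smul_mem_smul (Ideal.subset_span (List.mem_map_of_mem hr)) trivial)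

lemma annihilator_le_annihilator_topCech (rs : List R) :
    Module.annihilator R N ≤ Module.annihilator R (TopCech N rs.get) := fun a ha =>
  Module.mem_annihilator.2 fun e => by
    obtain ⟨t, m, rfl⟩ := exists_cechClass_eq _ e
    rw [← map_smul, Module.mem_annihilator.1 ha, map_zero]

variable [IsLocalRing R]

/-- If `H_{rs, y}(N) = 0` then every element of `H_rs(N)` is divisible by `y`, up to elements killed
by a power of `y`. -/
lemma exists_pow_smul_sub_smul_eq_zero {rs : List R} {y : R}
    (hv : ¬ TopNonzeroAt N (rs ++ [y]) (maximalIdeal R)) (e : TopCech N rs.get) :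
    ∃ e' u, y ^ u • (e - y • e') = 0 := by
  obtain ⟨t, m, rfl⟩ := exists_cechClass_eq _ e
  rw [← cechClass_add_pow rs.get t 1 m]
  generalize (∏ j, rs.get j) ^ 1 • m = m
  obtain ⟨s, hs, u, hu⟩ : ∃ s ∉ maximalIdeal R, ∃ u, s • (rs ++ [y]).prod ^ u • m ∈
      (Ideal.ofList ((rs ++ [y]).map (· ^ (t + 1 + u))) • ⊤ : Submodule R N) := by
    simp only [TopNonzeroAt] at hv
    push Not at hv
    exact hv (t + 1) m
  rw [Submodule.smul_mem_iff_of_isUnit _ (notMem_maximalIdeal.1 hs), List.map_append,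
    Ideal.ofList_append, sup_comm, Submodule.sup_smul, List.map_singleton, Ideal.ofList_singleton,
    Submodule.ideal_span_singleton_smul, Submodule.mem_sup] at hu
  obtain ⟨_, ⟨k, _, rfl⟩, z, hz, hzu⟩ := hu
  have hprod : (∏ j, rs.get j) ^ u • y ^ u • m = y ^ (t + 1 + u) • k + z := by
    rw [smul_smul, ← mul_pow, prod_get_eq_prod, ← List.prod_concat, List.concat_eq_append]
    exact hzu.symm
  refine ⟨y ^ t • cechClass N rs.get (t + 1 + u) k, u, ?_⟩
  rw [smul_sub, sub_eq_zero, ← map_smul, ← cechClass_add_pow rs.get (t + 1) u, hprod, map_add,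
    cechClass_eq_zero_of_mem hz, add_zero, map_smul]
  module

variable [IsNoetherian R N]

lemma mem_of_cechClass_eq_zero {rs : List R} (hm : ∀ a ∈ rs, a ∈ maximalIdeal R)
    (h : IsWeaklyRegular N rs) {t : ℕ} {n : N} (hn : cechClass N rs.get (t + 1) n = 0) :
    n ∈ (Ideal.ofList (rs.map (· ^ (t + 1))) • ⊤ : Submodule R N) := by
  obtain ⟨u, hu⟩ := (cechClass_get_eq_zero_iff _ _ _).1 hn
  exact mem_of_prod_pow_smul_mem hm h t u hu

lemma exists_cechClass_one_eq {rs : List R} (hm : ∀ a ∈ rs, a ∈ maximalIdeal R)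
    (h : IsWeaklyRegular N rs) {e : TopCech N rs.get}
    (he : e ∈ killedBy (TopCech N rs.get) rs) : ∃ n, cechClass N rs.get 1 n = e := by
  obtain ⟨t, m, rfl⟩ := exists_cechClass_eq _ e
  rw [← cechClass_add_pow rs.get t 1 m] at he ⊢
  obtain ⟨n, hn⟩ := exists_sub_prod_pow_smul_mem hm h t (n := (∏ j, rs.get j) ^ 1 • m)
    fun r hr => mem_of_cechClass_eq_zero hm h (by rw [map_smul]; exact mem_killedBy.1 he r hr)
  refine ⟨n, ?_⟩
  have h0 := cechClass_eq_zero_of_mem hn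
  rw [← prod_get_eq_prod, map_sub, sub_eq_zero] at h0
  rw [h0, add_comm t 1, cechClass_add_pow]

lemma isNoetherian_killedBy_topCech {rs : List R} (hm : ∀ a ∈ rs, a ∈ maximalIdeal R)
    (h : IsWeaklyRegular N rs) : IsNoetherian R (killedBy (TopCech N rs.get) rs) := by
  have hle : killedBy (TopCech N rs.get) rs ≤ LinearMap.range (cechClass N rs.get 1) :=
    fun e he => exists_cechClass_one_eq hm h he
  exact isNoetherian_of_injective (Submodule.inclusion hle) (Submodule.inclusion_injective hle)

end TopCech

variable {R : Type*} [CommRing R] [IsLocalRing R] [IsNoetherianRing R]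

lemma isArtinian_torsion'_powers {E : Type*} [AddCommGroup E] [Module R E] {rs : List R} {y : R}
    (htor : ∀ r ∈ rs, ∀ e : E, ∃ n : ℕ, r ^ n • e = 0) [IsNoetherian R (killedBy E rs)]
    {I : Ideal R} (hI : I ≤ Module.annihilator R E)
    (hmin : maximalIdeal R ∈ (I ⊔ Ideal.ofList (rs ++ [y])).minimalPrimes) :
    IsArtinian R (Submodule.torsion' R E (Submonoid.powers y)) := by
  set T := Submodule.torsion' R E (Submonoid.powers y)
  have hle : ∀ t ∈ killedBy T (rs ++ [y]), (t : E) ∈ killedBy E rs := fun t ht =>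
    mem_killedBy.2 fun r hr => congrArg Subtype.val
      (mem_killedBy.1 ht r (List.mem_append_left [y] hr))
  have hfin : IsNoetherian R (killedBy T (rs ++ [y])) :=
    isNoetherian_of_injective (T.subtype.restrict hle) fun a b hab =>
      Subtype.ext (Subtype.ext (congrArg (killedBy E rs).subtype hab))
  have := quotient_artinian_of_mem_minimalPrimes_of_isLocalRing _ hmin
  have hart : IsArtinian R (killedBy T (rs ++ [y])) := by
    refine isArtinian_of_isTorsionBySet (J := I ⊔ Ideal.ofList (rs ++ [y])) fun t a => ?_
    have hker : I ⊔ Ideal.ofList (rs ++ [y]) ≤ Ideal.torsionOf R _ t :=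
      sup_le (fun a ha => Subtype.ext (Subtype.ext (Module.mem_annihilator.1 (hI ha) _)))
        (Ideal.span_le.2 fun a ha => Subtype.ext (mem_killedBy.1 t.2 a ha))
    exact hker a.2
  refine isArtinian_of_isArtinian_killedBy (rs := rs ++ [y]) fun r hr t => ?_
  rcases List.mem_append.1 hr with hr | hr
  · obtain ⟨n, hn⟩ := htor r hr t
    exact ⟨n, Subtype.ext hn⟩
  · obtain ⟨⟨_, n, rfl⟩, hn⟩ := t.2
    exact ⟨n, Subtype.ext (List.mem_singleton.1 hr ▸ hn)⟩

variable {N : Type*} [AddCommGroup N] [Module R N] [Module.Finite R N]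

/-- Multiplication by `y` is injective on `E / T`, and surjective if `H_{rs, y}(N) = 0`; so it is
bijective on the elements killed by `rs`, which form a finite module. -/
lemma killedBy_topCech_quotient_torsion'_eq_bot {rs : List R} {y : R}
    (hm : ∀ a ∈ rs ++ [y], a ∈ maximalIdeal R) (h : IsWeaklyRegular N rs) {I : Ideal R}
    (hI : I ≤ Module.annihilator R N)
    (hmin : maximalIdeal R ∈ (I ⊔ Ideal.ofList (rs ++ [y])).minimalPrimes)
    (hv : ¬ TopNonzeroAt N (rs ++ [y]) (maximalIdeal R)) :
    killedBy (TopCech N rs.get ⧸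
      Submodule.torsion' R (TopCech N rs.get) (Submonoid.powers y)) rs = ⊥ := by
  set T := Submodule.torsion' R (TopCech N rs.get) (Submonoid.powers y)
  have hker : IsArtinian R (LinearMap.ker T.mkQ) := by
    have := isNoetherian_killedBy_topCech (fun a ha => hm a (List.mem_append_left _ ha)) h
    rw [Submodule.ker_mkQ]
    refine isArtinian_torsion'_powers (fun r hr e => ?_)
      (hI.trans (annihilator_le_annihilator_topCech rs)) hmin
    obtain ⟨t, m, rfl⟩ := exists_cechClass_eq _ e
    exact ⟨t, pow_smul_cechClass_of_mem hr t m⟩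
  have hfin : IsNoetherian R (killedBy (TopCech N rs.get ⧸ T) rs) := by
    have := isNoetherian_killedBy_topCech (fun a ha => hm a (List.mem_append_left _ ha)) h
    exact isNoetherian_killedBy_of_surjective rs T.mkQ_surjective
  refine Submodule.eq_bot_of_le_smul_of_le_jacobson_bot (Ideal.span {y}) _
    (Module.Finite.iff_fg.1 inferInstance) (fun c hc => ?_) <|
      (Ideal.span_singleton_le_iff_mem _).2 <| maximalIdeal_le_jacobson _ <|
        hm y (List.mem_append_right _ (List.mem_singleton_self y))
  obtain ⟨e, rfl⟩ := T.mkQ_surjective c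
  obtain ⟨e', u, hu⟩ := exists_pow_smul_sub_smul_eq_zero hv e
  have hee' : T.mkQ e = y • T.mkQ e' := by
    rw [← map_smul, ← sub_eq_zero, ← map_sub]
    exact (Submodule.Quotient.mk_eq_zero T).2 ⟨⟨_, u, rfl⟩, hu⟩
  rw [hee'] at hc ⊢
  refine Submodule.smul_mem_smul (Ideal.mem_span_singleton_self y) (mem_killedBy.2 fun r hr => ?_)
  have hry := mem_killedBy.1 hc r hr
  rw [← map_smul, ← map_smul] at hry
  obtain ⟨⟨_, n, rfl⟩, hn⟩ := (Submodule.Quotient.mk_eq_zero T).1 hry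
  rw [← map_smul]
  refine (Submodule.Quotient.mk_eq_zero T).2 ⟨⟨_, n + 1, rfl⟩, ?_⟩
  calc y ^ (n + 1) • r • e' = y ^ n • r • y • e' := by module
    _ = 0 := hn

theorem exists_pow_smul_mem_of_not_topNonzeroAt {rs : List R} {y : R}
    (hm : ∀ a ∈ rs ++ [y], a ∈ maximalIdeal R) (h : IsWeaklyRegular N rs) {I : Ideal R}
    (hI : I ≤ Module.annihilator R N)
    (hmin : maximalIdeal R ∈ (I ⊔ Ideal.ofList (rs ++ [y])).minimalPrimes)
    (hv : ¬ TopNonzeroAt N (rs ++ [y]) (maximalIdeal R)) (n : N) :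
    ∃ s : ℕ, y ^ s • n ∈ (Ideal.ofList rs • ⊤ : Submodule R N) := by
  set T := Submodule.torsion' R (TopCech N rs.get) (Submonoid.powers y)
  have hmem : T.mkQ (cechClass N rs.get 1 n) ∈ killedBy (TopCech N rs.get ⧸ T) rs :=
    mem_killedBy.2 fun r hr => by
      rw [← map_smul, ← pow_one r, pow_smul_cechClass_of_mem hr, map_zero]
  rw [killedBy_topCech_quotient_torsion'_eq_bot hm h hI hmin hv, Submodule.mem_bot] at hmem
  obtain ⟨⟨_, s, rfl⟩, hs⟩ := (Submodule.Quotient.mk_eq_zero T).1 hmem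
  refine ⟨s, ?_⟩
  have hs' : cechClass N rs.get 1 (y ^ s • n) = 0 := (map_smul _ _ _).trans hs
  simpa only [zero_add, pow_one, List.map_id'] using
    mem_of_cechClass_eq_zero (fun a ha => hm a (List.mem_append_left _ ha)) h (t := 0) hs'

end Nonvanishing

section Localization

open IsLocalRing

variable {R : Type*} [CommRing R] {N : Type*} [AddCommGroup N] [Module R N]
  (P : Ideal R) [P.IsPrime]

lemma mkLinearMap_mem_map_smul_top_iff {J : Ideal R} {n : N} :
    LocalizedModule.mkLinearMap P.primeCompl N n ∈
      (J.map (algebraMap R (Localization.AtPrime P)) • ⊤ :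
        Submodule (Localization.AtPrime P) (LocalizedModule P.primeCompl N)) ↔
      ∃ b ∉ P, b • n ∈ (J • ⊤ : Submodule R N) := by
  have hmap : (J.map (algebraMap R (Localization.AtPrime P)) • ⊤ :
      Submodule (Localization.AtPrime P) (LocalizedModule P.primeCompl N)) =
      (J • ⊤ : Submodule R N).localized' (Localization.AtPrime P) P.primeCompl
        (LocalizedModule.mkLinearMap P.primeCompl N) := by
    rw [Submodule.localized'_smul, Submodule.localized'_top, Ideal.localized'_eq_map]
  rw [hmap, Submodule.mem_localized']
  constructor
  · rintro ⟨k, hk, s, hs⟩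
    rw [IsLocalizedModule.mk'_eq_iff, Submonoid.smul_def, ← map_smul,
      IsLocalizedModule.eq_iff_exists P.primeCompl] at hs
    obtain ⟨c, hc⟩ := hs
    refine ⟨c * s, (c * s).2, ?_⟩
    rw [mul_smul, ← Submonoid.smul_def, ← hc]
    exact Submodule.smul_mem _ _ hk
  · rintro ⟨b, hb, hbn⟩
    exact ⟨_, hbn, ⟨b, hb⟩, (IsLocalizedModule.mk'_eq_iff).2 (map_smul _ _ _)⟩

lemma ofList_map_map_pow {A B : Type*} [CommRing A] [CommRing B] (f : A →+* B) (rs : List A)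
    (k : ℕ) :
    Ideal.ofList ((rs.map f).map (· ^ k)) = (Ideal.ofList (rs.map (· ^ k))).map f := by
  rw [Ideal.map_ofList, List.map_map, List.map_map]
  exact congrArg Ideal.ofList (List.map_congr_left fun a _ => (map_pow f a k).symm)

lemma topNonzeroAt_of_localized {rs : List R}
    (h : TopNonzeroAt (LocalizedModule P.primeCompl N)
      (rs.map (algebraMap R (Localization.AtPrime P))) (maximalIdeal (Localization.AtPrime P))) :
    TopNonzeroAt N rs P := by
  obtain ⟨t, z, h⟩ := h
  induction z using LocalizedModule.induction_on with
  | h n b =>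
    have hb : (b : R) • (LocalizedModule.mk n b : LocalizedModule P.primeCompl N) =
        LocalizedModule.mkLinearMap P.primeCompl N n := by
      rw [LocalizedModule.smul'_mk]
      exact LocalizedModule.mk_cancel b n
    refine ⟨t, n, fun s hs u hu => h (algebraMap R _ (s * b)) (fun hsb => ?_) u ?_⟩
    · rw [IsLocalization.AtPrime.to_map_mem_maximal_iff _ P] at hsb
      exact (‹P.IsPrime›.mem_or_mem hsb).elim hs b.2
    · rw [ofList_map_map_pow, ← map_list_prod, ← map_pow, algebraMap_smul, algebraMap_smul,
        mul_smul, smul_comm (b : R), hb, ← map_smul, ← map_smul, mkLinearMap_mem_map_smul_top_iff]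
      exact ⟨1, P.primeCompl.one_mem, by rwa [one_smul]⟩

end Localization

section Parameter

open IsLocalRing

variable {R : Type*} [CommRing R] {N : Type*} [AddCommGroup N] [Module R N] [Module.Finite R N]

lemma mem_support_quotient_smul_top_iff {J : Ideal R} {p : PrimeSpectrum R} :
    p ∈ Module.support R (N ⧸ (J • ⊤ : Submodule R N)) ↔
      Module.annihilator R N ⊔ J ≤ p.asIdeal := by
  rw [Module.support_quotient, Set.mem_inter_iff, Module.mem_support_iff_of_finite, sup_le_iff]
  rfl

/-- Otherwise a power of `y` kills `N / (rs)N` after localization at `P`, so `y` lies in every prime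
`q ≤ P` of the support of `N / (rs)N`. -/
theorem topNonzeroAt_append_singleton [IsNoetherianRing R] {rs : List R} (h : IsWeaklyRegular N rs)
    {y : R} (hy : ∀ q ∈ (Module.annihilator R N ⊔ Ideal.ofList rs).minimalPrimes, y ∉ q)
    {P : Ideal R} (hP : P ∈ (Module.annihilator R N ⊔ Ideal.ofList (rs ++ [y])).minimalPrimes) :
    TopNonzeroAt N (rs ++ [y]) P := by
  have := hP.1.1
  by_contra hv
  set A := Localization.AtPrime P
  have hlist : (rs ++ [y]).map (algebraMap R A) = rs.map (algebraMap R A) ++ [algebraMap R A y] :=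
    List.map_append
  have hann : (Module.annihilator R N).map (algebraMap R A) ≤
      Module.annihilator A (LocalizedModule P.primeCompl N) := by
    refine Ideal.map_le_iff_le_comap.2 fun a ha => Module.mem_annihilator.2 fun z => ?_
    induction z using LocalizedModule.induction_on with
    | h n b => rw [algebraMap_smul, LocalizedModule.smul'_mk, Module.mem_annihilator.1 ha,
        LocalizedModule.zero_mk]
  have hmin : maximalIdeal A ∈ ((Module.annihilator R N).map (algebraMap R A) ⊔
      Ideal.ofList (rs.map (algebraMap R A) ++ [algebraMap R A y])).minimalPrimes := by
    rw [← hlist, ← Ideal.map_ofList, ← Ideal.map_sup, IsLocalization.minimalPrimes_map P.primeCompl,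
      Set.mem_preimage, Localization.AtPrime.under_maximalIdeal]
    exact hP
  have hmax : ∀ a ∈ rs.map (algebraMap R A) ++ [algebraMap R A y], a ∈ maximalIdeal A := fun a ha =>
    hmin.1.2 (Ideal.mem_sup_right (Ideal.subset_span ha))
  obtain ⟨q, hq, hqP⟩ := Ideal.exists_minimalPrimes_le
    (show Module.annihilator R N ⊔ Ideal.ofList rs ≤ P from
      (sup_le_sup_left (Ideal.span_mono fun a ha => List.mem_append_left _ ha) _).trans hP.1.2)
  obtain ⟨m, hm⟩ := Module.mem_support_iff'.1 ((mem_support_quotient_smul_top_iff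
    (p := ⟨q, hq.1.1⟩)).2 hq.1.2)
  obtain ⟨m, rfl⟩ := Submodule.mkQ_surjective _ m
  obtain ⟨s, hs⟩ := exists_pow_smul_mem_of_not_topNonzeroAt hmax
    (h.of_isLocalizedModule A P.primeCompl (LocalizedModule.mkLinearMap P.primeCompl N)) hann hmin
    (fun hA => hv (topNonzeroAt_of_localized P (hlist ▸ hA)))
    (LocalizedModule.mkLinearMap P.primeCompl N m)
  rw [← map_pow, algebraMap_smul, ← map_smul, ← Ideal.map_ofList,
    mkLinearMap_mem_map_smul_top_iff] at hs
  obtain ⟨b, hb, hbm⟩ := hs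
  rw [smul_smul] at hbm
  exact hm (b * y ^ s) (hq.1.1.mul_notMem (fun hbq => hb (hqP hbq))
    fun hyq => hy q hq (hq.1.1.mem_of_pow_mem s hyq)) ((Submodule.Quotient.mk_eq_zero _).2 hbm)

variable [IsLocalRing R]

lemma ofList_smul_top_ne_top [Nontrivial N] {rs : List R}
    (hm : ∀ a ∈ rs, a ∈ maximalIdeal R) : Ideal.ofList rs • (⊤ : Submodule R N) ≠ ⊤ :=
  (Submodule.top_ne_ideal_smul_of_le_jacobson_annihilator
    ((Ideal.span_le.mpr hm).trans (maximalIdeal_le_jacobson _))).symm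

lemma supportDim_quotient_le_zero_of_mem_minimalPrimes {J : Ideal R}
    (h : maximalIdeal R ∈ (Module.annihilator R N ⊔ J).minimalPrimes) :
    Module.supportDim R (N ⧸ (J • ⊤ : Submodule R N)) ≤ 0 := by
  have hsub : Subsingleton (Module.support R (N ⧸ (J • ⊤ : Submodule R N))) := by
    have heq (p : Module.support R (N ⧸ (J • ⊤ : Submodule R N))) : p.1.asIdeal = maximalIdeal R :=
      have hle := le_maximalIdeal p.1.2.ne_top
      le_antisymm hle (h.2 ⟨p.1.2, mem_support_quotient_smul_top_iff.1 p.2⟩ hle)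
    exact ⟨fun p q => Subtype.ext (PrimeSpectrum.ext ((heq p).trans (heq q).symm))⟩
  exact Order.krullDim_nonpos_of_subsingleton

lemma isStrongParameterSeq_append_singleton_iff {R : Type*} [CommRing R] {N : Type*}
    [AddCommGroup N] [Module R N] {rs : List R} {y : R} :
    IsStrongParameterSeq R N (rs ++ [y]) ↔
      IsStrongParameterSeq R N rs ∧ IsParameterSeq R N (rs ++ [y]) := by
  constructor
  · refine fun h => ⟨fun i hi hirs => ?_, ?_⟩
    · rw [← List.take_append_of_le_length hirs (l₂ := [y])]
      exact h i hi (hirs.trans (List.length_append ▸ Nat.le_add_right _ _))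
    · rw [← List.take_length (l := rs ++ [y])]
      exact h _ (List.length_pos_of_ne_nil (List.append_ne_nil_of_right_ne_nil _
        (List.cons_ne_nil y []))) le_rfl
  · rintro ⟨h, hy⟩ i hi hirs
    rcases hirs.lt_or_eq with hlt | rfl
    · have hle : i ≤ rs.length := by simpa only [List.length_append, List.length_singleton,
        Nat.lt_succ_iff] using hlt
      rw [List.take_append_of_le_length hle]
      exact h i hi hle
    · rwa [List.take_length]

variable [IsNoetherianRing R]

lemma exists_mem_maximalIdeal_forall_notMem_minimalPrimes {I : Ideal R}
    (h : maximalIdeal R ∉ I.minimalPrimes) :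
    ∃ y ∈ maximalIdeal R, ∀ q ∈ I.minimalPrimes, y ∉ q := by
  by_contra! hcon
  have hfin := I.finite_minimalPrimes_of_isNoetherianRing R
  obtain ⟨q, hq, hle⟩ := (Ideal.subset_union_prime (s := hfin.toFinset) (f := id) ⊥ ⊥
    (I := maximalIdeal R) fun q hq _ _ => (hfin.mem_toFinset.1 hq).1.1).1 fun y hy => by
      obtain ⟨q, hq, hyq⟩ := hcon y hy
      exact Set.mem_biUnion (hfin.mem_toFinset.2 hq) hyq
  have hq' := hfin.mem_toFinset.1 hq
  exact h ((le_maximalIdeal hq'.1.1.ne_top).antisymm hle ▸ hq')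

variable [Nontrivial N]

theorem isParameterSeq_append_singleton {rs : List R} (h : IsWeaklyRegular N rs) {y : R}
    (hm : ∀ a ∈ rs ++ [y], a ∈ maximalIdeal R)
    (hy : ∀ q ∈ (Module.annihilator R N ⊔ Ideal.ofList rs).minimalPrimes, y ∉ q) :
    IsParameterSeq R N (rs ++ [y]) := by
  refine (isParameterSeq_iff _).2 ⟨ofList_smul_top_ne_top hm, fun p hp => ?_⟩
  obtain ⟨P, hP, hPp⟩ := Ideal.exists_minimalPrimes_le (mem_support_quotient_smul_top_iff.1 hp)
  exact (topNonzeroAt_append_singleton h hy hP).mono hPp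

theorem IsCohenMacaulay.exists_isRegular (hN : IsCohenMacaulay R N) (k : ℕ)
    (hk : (k : WithBot ℕ∞) ≤ Module.supportDim R N) :
    ∃ rs : List R, rs.length = k ∧ IsRegular N rs := by
  induction k with
  | zero => exact ⟨[], rfl, .nil R N⟩
  | succ k ih =>
    obtain ⟨rs, rfl, hreg⟩ := ih (le_trans (by exact_mod_cast Nat.le_succ k) hk)
    have hm := mem_maximalIdeal_of_ofList_smul_ne_top hreg.top_ne_smul.symm
    have hmin : maximalIdeal R ∉ (Module.annihilator R N ⊔ Ideal.ofList rs).minimalPrimes := by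
      intro hmin
      have hle := supportDim_quotient_le_zero_of_mem_minimalPrimes hmin
      have hlt : ((rs.length + 1 : ℕ) : WithBot ℕ∞) ≤ rs.length :=
        calc _ ≤ Module.supportDim R N := hk
          _ = _ := (Module.supportDim_add_length_eq_supportDim_of_isRegular rs hreg).symm
          _ ≤ 0 + (rs.length : WithBot ℕ∞) := by gcongr
          _ = rs.length := zero_add _
      exact Nat.not_succ_le_self _ (by exact_mod_cast hlt)
    obtain ⟨y, hym, hy⟩ := exists_mem_maximalIdeal_forall_notMem_minimalPrimes hmin
    have hm' : ∀ a ∈ rs ++ [y], a ∈ maximalIdeal R := by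
      simpa only [List.forall_mem_append, List.forall_mem_singleton] using ⟨hm, hym⟩
    refine ⟨rs ++ [y], List.length_append, (hN _ ?_).resolve_left
      (List.append_ne_nil_of_right_ne_nil _ (List.cons_ne_nil y []))⟩
    exact isStrongParameterSeq_append_singleton_iff.2 ⟨isStrongParameterSeq_of_isRegular hreg,
      isParameterSeq_append_singleton hreg.toIsWeaklyRegular hm' hy⟩

end Parameter

section Depth

open IsLocalRing CategoryTheory Abelian

universe u v

variable {R : Type u} [CommRing R]

lemma ringKrullDim_quotient_add_one_le {p q : Ideal R} [p.IsPrime] (h : p < q) :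
    ringKrullDim (R ⧸ q) + 1 ≤ ringKrullDim (R ⧸ p) := by
  obtain ⟨z, hzq, hzp⟩ := SetLike.exists_of_lt h
  exact ringKrullDim_succ_le_of_surjective (Ideal.Quotient.factor h.le)
    (Ideal.Quotient.factor_surjective h.le)
    (mem_nonZeroDivisors_of_ne_zero fun hz => hzp (Ideal.Quotient.eq_zero_iff_mem.1 hz))
    (Ideal.Quotient.eq_zero_iff_mem.2 hzq)

variable [IsLocalRing R]

lemma maximalIdeal_smul_top_lt_top (N : Type*) [AddCommGroup N] [Module R N] [Module.Finite R N]
    [Nontrivial N] : maximalIdeal R • (⊤ : Submodule R N) < ⊤ :=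
  lt_top_iff_ne_top.2 (Submodule.top_ne_ideal_smul_of_le_jacobson_annihilator
    (maximalIdeal_le_jacobson _)).symm

variable [IsNoetherianRing R]

lemma exists_isRegular_quotSMulTop_of_small {N : Type v} [Small.{v} R] [AddCommGroup N] [Module R N]
    [Module.Finite R N] {x : R} (hx : IsSMulRegular N x) (hxm : x ∈ maximalIdeal R) {rs : List R}
    (hrs : IsRegular N rs) {k : ℕ} (hk : rs.length = k + 1) :
    ∃ ss : List R, ss.length = k ∧ IsRegular (QuotSMulTop x N) ss := by
  have hN := hrs.nontrivial
  have hNx : Nontrivial (QuotSMulTop x N) := by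
    have hreg : IsRegular N [x] := (isRegular_iff_isWeaklyRegular_of_subset_maximalIdeal
      (List.forall_mem_singleton.2 hxm)).2 ((isWeaklyRegular_singleton_iff _ _).2 hx)
    exact ((isRegular_cons_iff _ _ _).1 hreg).2.nontrivial
  have rees := (ModuleCat.exists_isRegular_tfae (maximalIdeal R) (k + 1) (ModuleCat.of R N)
    (maximalIdeal_smul_top_lt_top N)).out 1 3
  have reesQuot := (ModuleCat.exists_isRegular_tfae (maximalIdeal R) k
    (ModuleCat.of R (QuotSMulTop x N)) (maximalIdeal_smul_top_lt_top _)).out 1 3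
  have hext := rees.2 ⟨rs, hk, mem_maximalIdeal_of_ofList_smul_ne_top hrs.top_ne_smul.symm, hrs⟩
  obtain ⟨ss, hss, -, hreg⟩ := reesQuot.1 fun i hi => by
    have zero₁ := AddCommGrpCat.isZero_of_iff_subsingleton.mpr (hext i (by omega))
    have zero₂ := AddCommGrpCat.isZero_of_iff_subsingleton.mpr (hext (i + 1) (by omega))
    exact AddCommGrpCat.subsingleton_of_isZero <| ShortComplex.Exact.isZero_of_both_zeros
      ((Ext.covariant_sequence_exact₃' _ (IsSMulRegular.smulShortComplex_shortExact
        (M := ModuleCat.of R N) hx)) i (i + 1) rfl)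
      (zero₁.eq_zero_of_src _) (zero₂.eq_zero_of_tgt _)
  exact ⟨ss, hss, hreg⟩

variable {N : Type v} [AddCommGroup N] [Module R N] [Module.Finite R N]

theorem exists_isRegular_quotSMulTop {x : R} (hx : IsSMulRegular N x) (hxm : x ∈ maximalIdeal R)
    {rs : List R} (hrs : IsRegular N rs) {k : ℕ} (hk : rs.length = k + 1) :
    ∃ ss : List R, ss.length = k ∧ IsRegular (QuotSMulTop x N) ss := by
  let e : ULift.{u} N ≃ₗ[R] N := ULift.moduleEquiv
  have := Module.Finite.equiv e.symm
  obtain ⟨ss, hss, hreg⟩ := exists_isRegular_quotSMulTop_of_small (N := ULift.{u} N)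
    ((e.isSMulRegular_congr x).2 hx) hxm ((e.isRegular_congr rs).2 hrs) hk
  exact ⟨ss, hss, ((QuotSMulTop.congr x e).isRegular_congr ss).1 hreg⟩

theorem exists_isRegular_quotient {rs ss : List R} (hrs : IsRegular N rs) (hss : IsRegular N ss)
    {k : ℕ} (hk : ss.length = rs.length + k) :
    ∃ ts : List R, ts.length = k ∧
      IsRegular (N ⧸ (Ideal.ofList rs • ⊤ : Submodule R N)) ts := by
  induction rs generalizing N ss with
  | nil =>
    let e : (N ⧸ (Ideal.ofList ([] : List R) • ⊤ : Submodule R N)) ≃ₗ[R] N :=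
      Submodule.quotEquivOfEqBot _ (by rw [Ideal.ofList_nil, Submodule.bot_smul])
    exact ⟨ss, by simpa using hk, (e.isRegular_congr ss).2 hss⟩
  | cons r rs ih =>
    have hm := mem_maximalIdeal_of_ofList_smul_ne_top hrs.top_ne_smul.symm
    rw [isRegular_cons_iff] at hrs
    obtain ⟨ts, hts, hreg⟩ := exists_isRegular_quotSMulTop hrs.1 (hm r List.mem_cons_self) hss
      (k := rs.length + k) (by rw [hk, List.length_cons]; ring)
    obtain ⟨us, hus, hreg⟩ := ih hrs.2 hreg hts
    exact ⟨us, hus, ((Submodule.quotOfListConsSMulTopEquivQuotSMulTopInner N r rs).isRegular_congr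
      us).2 hreg⟩

lemma exists_mem_torsionBySet_forall_smul_ne {s : Set R} (hs : Submodule.torsionBySet R N s ≠ ⊥)
    {z : R} (hz : IsSMulRegular N z) (hzm : z ∈ maximalIdeal R) :
    ∃ n ∈ Submodule.torsionBySet R N s, ∀ k, z • k ≠ n := by
  by_contra! hdiv
  refine hs (Submodule.eq_bot_of_le_smul_of_le_jacobson_bot (Ideal.span {z}) _
    (IsNoetherian.noetherian _) (fun n hn => ?_) ?_)
  · obtain ⟨k, rfl⟩ := hdiv n hn
    refine Submodule.smul_mem_smul (Ideal.mem_span_singleton_self z) ?_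
    rw [Submodule.mem_torsionBySet_iff] at hn ⊢
    intro a
    refine isSMulRegular_iff_right_eq_zero_of_smul.1 hz _ ?_
    rw [smul_comm, hn a]
  · rwa [IsLocalRing.jacobson_eq_maximalIdeal _ bot_ne_top, Ideal.span_singleton_le_iff_mem]

lemma exists_isAssociatedPrime_quotSMulTop {p : Ideal R} (hp : IsAssociatedPrime p N) {z : R}
    (hz : IsSMulRegular N z) (hzm : z ∈ maximalIdeal R) :
    ∃ q, IsAssociatedPrime q (QuotSMulTop z N) ∧ p < q := by
  obtain ⟨hprime, x, hx⟩ := isAssociatedPrime_iff.1 hp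
  have hxp : ∀ a, a ∈ p ↔ a • x = 0 := fun a => by
    rw [hx, Submodule.mem_colon_singleton, Submodule.mem_bot]
  have hx0 : x ≠ 0 := fun h =>
    hprime.ne_top ((Ideal.eq_top_iff_one _).2 ((hxp 1).2 (by rw [h, smul_zero])))
  have hzp : z ∉ p := fun h => hx0 (isSMulRegular_iff_right_eq_zero_of_smul.1 hz _ ((hxp z).1 h))
  have htors : Submodule.torsionBySet R N (p : Set R) ≠ ⊥ := (Submodule.ne_bot_iff _).2
    ⟨x, (Submodule.mem_torsionBySet_iff _ _).2 fun a => (hxp a).1 a.2, hx0⟩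
  obtain ⟨n, hnp, hn⟩ := exists_mem_torsionBySet_forall_smul_ne htors hz hzm
  obtain ⟨q, hq, hle⟩ := exists_le_isAssociatedPrime_of_isNoetherianRing R
    (Submodule.Quotient.mk n : QuotSMulTop z N)
    (fun h => ((mk_quotSMulTop_eq_zero_iff _ _).1 h).elim hn)
  have hmem : ∀ a : R, (Submodule.Quotient.mk (a • n) : QuotSMulTop z N) = 0 → a ∈ q := fun a ha =>
    hle (Submodule.mem_colon_singleton.2 ((Submodule.mem_bot R).2 ha))
  refine ⟨q, hq, SetLike.lt_iff_le_and_exists.2 ⟨fun a ha => hmem a ?_,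
    z, hmem z ((mk_quotSMulTop_eq_zero_iff _ _).2 ⟨n, rfl⟩), hzp⟩⟩
  rw [(Submodule.mem_torsionBySet_iff _ _).1 hnp ⟨a, ha⟩, Submodule.Quotient.mk_zero]

theorem length_le_ringKrullDim_of_isAssociatedPrime {rs : List R} (hrs : IsRegular N rs)
    {p : Ideal R} (hp : IsAssociatedPrime p N) :
    (rs.length : WithBot ℕ∞) ≤ ringKrullDim (R ⧸ p) := by
  have hprime := hp.1
  induction rs generalizing N p with
  | nil => exact ringKrullDim_nonneg_of_nontrivial
  | cons r rs ih =>
    have hm := mem_maximalIdeal_of_ofList_smul_ne_top hrs.top_ne_smul.symm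
    rw [isRegular_cons_iff] at hrs
    obtain ⟨q, hq, hlt⟩ := exists_isAssociatedPrime_quotSMulTop hp hrs.1 (hm r List.mem_cons_self)
    calc ((r :: rs).length : WithBot ℕ∞) = rs.length + 1 := by
          rw [List.length_cons, Nat.cast_add, Nat.cast_one]
      _ ≤ ringKrullDim (R ⧸ q) + 1 := by gcongr; exact ih hrs.2 hq hq.1
      _ ≤ ringKrullDim (R ⧸ p) := ringKrullDim_quotient_add_one_le hlt

theorem length_le_ringKrullDim_add_length_of_isAssociatedPrime {rs ss : List R}
    (hrs : IsRegular N rs) (hss : IsRegular N ss) {p : Ideal R}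
    (hp : IsAssociatedPrime p (N ⧸ (Ideal.ofList rs • ⊤ : Submodule R N))) :
    (ss.length : WithBot ℕ∞) ≤ ringKrullDim (R ⧸ p) + rs.length := by
  rcases le_total ss.length rs.length with hle | hle
  · have hprime := hp.1
    exact (Nat.cast_le.2 hle).trans (le_add_of_nonneg_left ringKrullDim_nonneg_of_nontrivial)
  · obtain ⟨k, hk⟩ := Nat.exists_eq_add_of_le hle
    obtain ⟨ts, rfl, hts⟩ := exists_isRegular_quotient hrs hss hk
    rw [hk, add_comm, Nat.cast_add]
    gcongr
    exact length_le_ringKrullDim_of_isAssociatedPrime hts hp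

end Depth

section Unmixed

open IsLocalRing

variable {R : Type*} [CommRing R]

lemma exists_mul_pow_mem_of_mem_minimalPrimes {I p : Ideal R} (hp : p ∈ I.minimalPrimes) {y : R}
    (hy : y ∈ p) : ∃ s ∉ p, ∃ c : ℕ, s * y ^ c ∈ I := by
  have := hp.1.1
  have hrad : algebraMap R (Localization.AtPrime p) y ∈
      (I.map (algebraMap R (Localization.AtPrime p))).radical := by
    rw [IsLocalization.AtPrime.radical_map_of_mem_minimalPrimes _ p I hp]
    exact Ideal.mem_map_of_mem _ hy
  obtain ⟨c, hc⟩ := hrad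
  rw [← map_pow, IsLocalization.algebraMap_mem_map_algebraMap_iff p.primeCompl] at hc
  obtain ⟨s, hs, h⟩ := hc
  exact ⟨s, hs, c, h⟩

lemma exists_ofList_pow_le (rs : List R) (t : ℕ) :
    ∃ k, Ideal.ofList rs ^ k ≤ Ideal.ofList (rs.map (· ^ t)) :=
  Ideal.exists_pow_le_of_le_radical_of_fg
    (Ideal.span_le.2 fun a ha => ⟨t, Ideal.subset_span (List.mem_map.2 ⟨a, ha, rfl⟩)⟩)
    (Submodule.fg_span (List.finite_toSet rs))

variable {N : Type*} [AddCommGroup N] [Module R N]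

lemma pow_smul_top_le_pow_smul_top {I J : Ideal R}
    (h : I • (⊤ : Submodule R N) ≤ J • ⊤) (j : ℕ) :
    I ^ j • (⊤ : Submodule R N) ≤ J ^ j • ⊤ := by
  induction j with
  | zero => rw [pow_zero, pow_zero]
  | succ j ih =>
    calc I ^ (j + 1) • (⊤ : Submodule R N) = I ^ j • I • ⊤ := by rw [pow_succ, Submodule.mul_smul]
      _ ≤ I ^ j • J • ⊤ := smul_mono_right _ h
      _ = J • I ^ j • ⊤ := by rw [← Submodule.mul_smul, mul_comm, Submodule.mul_smul]
      _ ≤ J • J ^ j • ⊤ := smul_mono_right _ ih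
      _ = J ^ (j + 1) • ⊤ := by rw [pow_succ', Submodule.mul_smul]

lemma annihilator_quotient_smul_top_le (L : Submodule R N) :
    Module.annihilator R (N ⧸ L) • (⊤ : Submodule R N) ≤ L :=
  Submodule.smul_le.2 fun _ ha n _ => (Submodule.Quotient.mk_eq_zero L).1
    (Module.mem_annihilator.1 ha (Submodule.Quotient.mk n))

lemma not_topNonzeroAt_append_singleton {rs : List R} {p : Ideal R}
    (hp : p ∈ (Module.annihilator R (N ⧸ (Ideal.ofList rs • ⊤ : Submodule R N))).minimalPrimes)
    {y : R} (hy : y ∈ p) : ¬ TopNonzeroAt N (rs ++ [y]) p := by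
  rintro ⟨t, m, h⟩
  obtain ⟨s, hs, c, hsc⟩ := exists_mul_pow_mem_of_mem_minimalPrimes hp hy
  obtain ⟨k, hk⟩ := exists_ofList_pow_le rs t
  have hsmul : (s * y ^ c) ^ k • m ∈ (Ideal.ofList (rs.map (· ^ t)) • ⊤ : Submodule R N) :=
    Submodule.smul_mono_left hk (pow_smul_top_le_pow_smul_top
      (annihilator_quotient_smul_top_le _) k
      (Submodule.smul_mem_smul (Ideal.pow_mem_pow hsc k) Submodule.mem_top))
  refine h (s ^ k) (fun h => hs (hp.1.1.mem_of_pow_mem _ h)) (c * k) ?_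
  have hsub : Ideal.ofList (rs.map (· ^ (t + c * k))) ≤
      Ideal.ofList ((rs ++ [y]).map (· ^ (t + c * k))) := by
    rw [List.map_append, Ideal.ofList_append]
    exact le_sup_left
  have heq : s ^ k • (rs ++ [y]).prod ^ (c * k) • m =
      rs.prod ^ (c * k) • (s * y ^ c) ^ k • m := by
    rw [List.prod_append, List.prod_singleton]
    module
  exact heq ▸ Submodule.smul_mono_left hsub (list_prod_pow_smul_mem rs (c * k) hsmul)

lemma annihilator_sup_le_annihilator_quotient (J : Ideal R) :
    Module.annihilator R N ⊔ J ≤ Module.annihilator R (N ⧸ (J • ⊤ : Submodule R N)) := by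
  refine sup_le (LinearMap.annihilator_le_of_surjective _ (Submodule.mkQ_surjective _))
    fun a ha => Module.mem_annihilator.2 fun n => ?_
  obtain ⟨n, rfl⟩ := Submodule.mkQ_surjective _ n
  rw [← map_smul, Submodule.mkQ_apply, Submodule.Quotient.mk_eq_zero]
  exact Submodule.smul_mem_smul ha Submodule.mem_top

lemma annihilator_sup_ofList_append_singleton_le {rs : List R} {y : R} {p : Ideal R}
    (hp : IsAssociatedPrime p (N ⧸ (Ideal.ofList rs • ⊤ : Submodule R N))) (hy : y ∈ p) :
    Module.annihilator R N ⊔ Ideal.ofList (rs ++ [y]) ≤ p := by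
  rw [Ideal.ofList_append, ← sup_assoc, Ideal.ofList_singleton]
  refine sup_le ((annihilator_sup_le_annihilator_quotient _).trans ?_)
    ((Ideal.span_singleton_le_iff_mem p).2 hy)
  simpa only [Submodule.annihilator_top] using hp.annihilator_le

lemma exists_isAssociatedPrime_mem_of_not_isSMulRegular [IsNoetherianRing R] {y : R}
    (hy : ¬ IsSMulRegular N y) : ∃ p, IsAssociatedPrime p N ∧ y ∈ p := by
  have hmem : y ∈ ⋃ p ∈ associatedPrimes R N, (p : Set R) := by
    rw [biUnion_associatedPrimes_eq_compl_regular]; exact hy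
  simpa only [Set.mem_iUnion, exists_prop] using! hmem

variable [IsLocalRing R] [IsNoetherianRing R] [Module.Finite R N]

/-- If the depth of `N` equals its dimension, this applies to every regular sequence `rs` and says
that `N ⧸ rs N` has no embedded primes. -/
lemma mem_minimalPrimes_annihilator_of_isAssociatedPrime {rs ss : List R} (hrs : IsRegular N rs)
    (hss : IsRegular N ss) (hdim : Module.supportDim R N = ss.length) {p : Ideal R}
    (hp : IsAssociatedPrime p (N ⧸ (Ideal.ofList rs • ⊤ : Submodule R N))) :
    p ∈ (Module.annihilator R (N ⧸ (Ideal.ofList rs • ⊤ : Submodule R N))).minimalPrimes := by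
  refine ⟨⟨hp.1, by simpa only [Submodule.annihilator_top] using hp.annihilator_le⟩,
    fun q hq hqp => ?_⟩
  by_contra hpq
  have := hq.1
  have hlt : ((ss.length + 1 : ℕ) : WithBot ℕ∞) ≤ ss.length :=
    calc ((ss.length + 1 : ℕ) : WithBot ℕ∞)
      _ ≤ ringKrullDim (R ⧸ p) + rs.length + 1 := by
        rw [Nat.cast_add, Nat.cast_one]
        gcongr
        exact length_le_ringKrullDim_add_length_of_isAssociatedPrime hrs hss hp
      _ = ringKrullDim (R ⧸ p) + 1 + rs.length := add_right_comm _ _ _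
      _ ≤ ringKrullDim (R ⧸ q) + rs.length := by
        gcongr
        exact ringKrullDim_quotient_add_one_le (lt_of_le_not_ge hqp hpq)
      _ ≤ Module.supportDim R (N ⧸ (Ideal.ofList rs • ⊤ : Submodule R N)) + rs.length := by
        rw [Module.supportDim_eq_ringKrullDim_quotient_annihilator]
        gcongr
        exact ringKrullDim_le_of_surjective (Ideal.Quotient.factor hq.2)
          (Ideal.Quotient.factor_surjective _)
      _ = ss.length := by rw [Module.supportDim_add_length_eq_supportDim_of_isRegular rs hrs, hdim]
  exact Nat.not_succ_le_self _ (by exact_mod_cast hlt)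

theorem isCohenMacaulay_of_supportDim_eq_length {ss : List R} (hss : IsRegular N ss)
    (hdim : Module.supportDim R N = ss.length) : IsCohenMacaulay R N := by
  have := hss.nontrivial
  suffices h : ∀ rs : List R, IsStrongParameterSeq R N rs → IsRegular N rs from
    fun rs hrs => .inr (h rs hrs)
  intro rs
  induction rs using List.reverseRecOn with
  | nil => exact fun _ => .nil R N
  | append_singleton rs y ih =>
    intro hpar
    obtain ⟨hrs, hy⟩ := isStrongParameterSeq_append_singleton_iff.1 hpar
    have hreg := ih hrs
    obtain ⟨hne, htop⟩ := (isParameterSeq_iff _).1 hy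
    refine ⟨?_, hne.symm⟩
    rw [isWeaklyRegular_append_iff, isWeaklyRegular_singleton_iff]
    refine ⟨hreg.toIsWeaklyRegular, ?_⟩
    by_contra hyreg
    obtain ⟨p, hp, hyp⟩ := exists_isAssociatedPrime_mem_of_not_isSMulRegular hyreg
    exact not_topNonzeroAt_append_singleton
      (mem_minimalPrimes_annihilator_of_isAssociatedPrime hreg hss hdim hp) hyp
      (htop ⟨p, hp.1⟩ (mem_support_quotient_smul_top_iff.2
        (annihilator_sup_ofList_append_singleton_le hp hyp)))

end Unmixed

section MaximalCohenMacaulay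

open IsLocalRing

variable {R : Type*} [CommRing R] [IsLocalRing R] [IsNoetherianRing R]
  {M : Type*} [AddCommGroup M] [Module R M] [Module.Finite R M]

lemma exists_ringKrullDim_eq_natCast (R : Type*) [CommRing R] [FiniteRingKrullDim R] :
    ∃ d : ℕ, ringKrullDim R = d := by
  obtain ⟨e, he⟩ := WithBot.ne_bot_iff_exists.1 (ringKrullDim_ne_bot (R := R))
  obtain ⟨d, rfl⟩ := (ENat.ne_top_iff_exists (n := e)).1 fun h =>
    ringKrullDim_ne_top (R := R) (he ▸ congrArg _ h)
  exact ⟨d, he.symm⟩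

lemma length_le_supportDim {rs : List R} (hrs : IsRegular M rs) :
    (rs.length : WithBot ℕ∞) ≤ Module.supportDim R M := by
  have : Nontrivial (M ⧸ (Ideal.ofList rs • ⊤ : Submodule R M)) :=
    hrs.quot_ofList_smul_nontrivial ⊤
  have : Nonempty (Module.support R (M ⧸ (Ideal.ofList rs • ⊤ : Submodule R M))) :=
    (Module.nonempty_support_of_nontrivial).to_subtype
  rw [← Module.supportDim_add_length_eq_supportDim_of_isRegular rs hrs]
  exact le_add_of_nonneg_left Order.krullDim_nonneg

theorem isMaximalCohenMacaulay_of_isRegular (hR : IsCohenMacaulay R R)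
    (h : ∀ rs : List R, IsRegular R rs → IsRegular M rs) : IsMaximalCohenMacaulay R M := by
  obtain ⟨d, hd⟩ := exists_ringKrullDim_eq_natCast R
  obtain ⟨rs, rfl, hreg⟩ := hR.exists_isRegular d
    (by rw [Module.supportDim_self_eq_ringKrullDim, hd])
  have hM := h rs hreg
  have hdim : Module.supportDim R M = rs.length :=
    le_antisymm ((Module.supportDim_le_ringKrullDim R M).trans hd.le) (length_le_supportDim hM)
  exact ⟨isCohenMacaulay_of_supportDim_eq_length hM hdim, hdim.trans hd.symm⟩

lemma isSMulRegular_quotient_of_ringKrullDim_eq_length {ss : List R} (hss : IsRegular M ss)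
    (hdim : ringKrullDim R = ss.length) {rs : List R} {y : R} (hrsy : IsRegular R (rs ++ [y]))
    (hrs : IsRegular M rs) : IsSMulRegular (M ⧸ (Ideal.ofList rs • ⊤ : Submodule R M)) y := by
  by_contra hy
  obtain ⟨p, hp, hyp⟩ := exists_isAssociatedPrime_mem_of_not_isSMulRegular hy
  have hsub : Ideal.ofList (rs ++ [y]) ≤ p :=
    le_sup_right.trans (annihilator_sup_ofList_append_singleton_le hp hyp)
  have hlt : ((ss.length + 1 : ℕ) : WithBot ℕ∞) ≤ ss.length :=
    calc ((ss.length + 1 : ℕ) : WithBot ℕ∞)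
      _ ≤ ringKrullDim (R ⧸ p) + rs.length + 1 := by
        rw [Nat.cast_add, Nat.cast_one]
        gcongr
        exact length_le_ringKrullDim_add_length_of_isAssociatedPrime hrs hss hp
      _ = ringKrullDim (R ⧸ p) + (rs ++ [y]).length := by
        rw [List.length_append, List.length_singleton, Nat.cast_add, Nat.cast_one, add_assoc]
      _ ≤ ringKrullDim (R ⧸ Ideal.ofList (rs ++ [y])) + (rs ++ [y]).length := by
        gcongr
        exact ringKrullDim_le_of_surjective (Ideal.Quotient.factor hsub)
          (Ideal.Quotient.factor_surjective _)
      _ = ss.length := by rw [ringKrullDim_add_length_eq_ringKrullDim_of_isRegular _ hrsy, hdim]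
  exact Nat.not_succ_le_self _ (by exact_mod_cast hlt)

theorem isRegular_of_isMaximalCohenMacaulay [Nontrivial M] (hM : IsMaximalCohenMacaulay R M)
    {rs : List R} (hrs : IsRegular R rs) : IsRegular M rs := by
  obtain ⟨d, hd⟩ := exists_ringKrullDim_eq_natCast R
  obtain ⟨ss, rfl, hss⟩ := hM.1.exists_isRegular d (by rw [hM.2, hd])
  induction rs using List.reverseRecOn with
  | nil => exact .nil R M
  | append_singleton rs y ih =>
    have hreg : IsRegular M rs := ih (by simpa using isRegular_take hrs rs.length)
    refine (isRegular_iff_isWeaklyRegular_of_subset_maximalIdeal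
      (mem_maximalIdeal_of_ofList_smul_ne_top hrs.top_ne_smul.symm)).2 ?_
    rw [isWeaklyRegular_append_iff, isWeaklyRegular_singleton_iff]
    exact ⟨hreg.toIsWeaklyRegular,
      isSMulRegular_quotient_of_ringKrullDim_eq_length hss hd hrs hreg⟩

end MaximalCohenMacaulay

section NilpotentKernel

variable {A B : Type*} [CommRing A] [CommRing B] {f : A →+* B}

lemma exists_mul_prod_pow_mul_mem_sup_pow {ys : List A} {P J : Ideal A} [P.IsPrime]
    (h : ∀ t, ∃ s ∉ P, ∃ u, s * ys.prod ^ u ∈ Ideal.ofList (ys.map (· ^ (t + u))) ⊔ J)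
    (k t : ℕ) (w : A) :
    ∃ s ∉ P, ∃ u, s * ys.prod ^ u * w ∈ Ideal.ofList (ys.map (· ^ (t + u))) ⊔ J ^ k := by
  induction k with
  | zero => exact ⟨1, P.one_notMem, 0, by rw [pow_zero, Ideal.one_eq_top, sup_top_eq]; trivial⟩
  | succ k ih =>
    obtain ⟨s, hs, u, hsu⟩ := ih
    obtain ⟨s', hs', u', hsu'⟩ := h (t + u)
    obtain ⟨a, ha, z, hz, haz⟩ := Submodule.mem_sup.1 hsu
    obtain ⟨b, hb, j, hj, hbj⟩ := Submodule.mem_sup.1 hsu'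
    refine ⟨s * s', P.primeCompl.mul_mem hs hs', u + u', ?_⟩
    have ha' : ys.prod ^ u' * a ∈ Ideal.ofList (ys.map (· ^ (t + u + u'))) := by
      rw [← Ideal.mul_top (Ideal.ofList _), ← smul_eq_mul] at ha ⊢
      exact list_prod_pow_smul_mem ys u' ha
    have hsplit : s * s' * ys.prod ^ (u + u') * w = s' * (ys.prod ^ u' * a) + b * z + j * z :=
      calc s * s' * ys.prod ^ (u + u') * w
        _ = s' * ys.prod ^ u' * (s * ys.prod ^ u * w) := by ring
        _ = s' * (ys.prod ^ u' * a) + s' * ys.prod ^ u' * z := by rw [← haz]; ring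
        _ = s' * (ys.prod ^ u' * a) + b * z + j * z := by rw [← hbj]; ring
    rw [hsplit, ← add_assoc t, pow_succ']
    exact add_mem (Ideal.mem_sup_left (add_mem (Ideal.mul_mem_left _ _ ha')
      (Ideal.mul_mem_right _ _ hb))) (Ideal.mem_sup_right (Ideal.mul_mem_mul hj hz))

lemma map_mem_ofList_map_pow_iff (hf : Function.Surjective f) {ys : List A} {k : ℕ} {a : A} :
    f a ∈ Ideal.ofList ((ys.map f).map (· ^ k)) ↔
      a ∈ Ideal.ofList (ys.map (· ^ k)) ⊔ RingHom.ker f := by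
  rw [ofList_map_map_pow, ← Ideal.mem_comap, Ideal.comap_map_of_surjective' f hf]

lemma topNonzeroAt_of_map (hf : Function.Surjective f) {ys : List A} {p : Ideal B}
    (h : TopNonzeroAt B (ys.map f) p) : TopNonzeroAt A ys (p.comap f) := by
  obtain ⟨t, b, h⟩ := h
  obtain ⟨a, rfl⟩ := hf b
  refine ⟨t, a, fun s hs u hsu => h (f s) hs u ?_⟩
  rw [smul_eq_mul (Ideal.ofList _), Ideal.mul_top] at hsu ⊢
  rw [← map_list_prod, ← map_pow, smul_eq_mul, smul_eq_mul, ← map_mul, ← map_mul,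
    map_mem_ofList_map_pow_iff hf]
  exact Ideal.mem_sup_left hsu

lemma topNonzeroAt_map (hf : Function.Surjective f) (hker : IsNilpotent (RingHom.ker f))
    {ys : List A} {p : Ideal B} [p.IsPrime] (h : TopNonzeroAt A ys (p.comap f)) :
    TopNonzeroAt B (ys.map f) p := by
  by_contra hB
  simp only [TopNonzeroAt, not_exists, not_forall, not_not] at hB
  obtain ⟨n, hn⟩ := hker
  obtain ⟨t, w, htw⟩ := h
  have hone : ∀ t, ∃ s ∉ p.comap f, ∃ u,
      s * ys.prod ^ u ∈ Ideal.ofList (ys.map (· ^ (t + u))) ⊔ RingHom.ker f := fun t => by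
    obtain ⟨b, hb, u, hbu⟩ := hB t 1
    obtain ⟨s, rfl⟩ := hf b
    refine ⟨s, hb, u, (map_mem_ofList_map_pow_iff hf).1 ?_⟩
    rwa [smul_eq_mul (Ideal.ofList _), Ideal.mul_top, ← map_list_prod, ← map_pow, smul_eq_mul,
      smul_eq_mul, mul_one, ← map_mul] at hbu
  obtain ⟨s, hs, u, hsu⟩ := exists_mul_prod_pow_mul_mem_sup_pow hone n t w
  refine htw s hs u ?_
  rwa [hn, Ideal.zero_eq_bot, sup_bot_eq, mul_assoc, ← Ideal.mul_top (Ideal.ofList _)] at hsu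

lemma isParameterSeq_self_iff [IsNoetherianRing A] {ys : List A} :
    IsParameterSeq A A ys ↔ Ideal.ofList ys ≠ ⊤ ∧
      ∀ p : Ideal A, p.IsPrime → Ideal.ofList ys ≤ p → TopNonzeroAt A ys p := by
  have hann : Module.annihilator A A = ⊥ := Module.annihilator_eq_bot.2 inferInstance
  rw [isParameterSeq_iff, smul_eq_mul, Ideal.mul_top]
  refine and_congr_right' ⟨fun h p hp hle => h ⟨p, hp⟩ ?_, fun h p hp => h _ p.isPrime ?_⟩
  · have hmem := mem_support_quotient_smul_top_iff (N := A) (J := Ideal.ofList ys) (p := ⟨p, hp⟩)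
    rw [smul_eq_mul, Ideal.mul_top] at hmem
    exact hmem.2 (sup_le (hann.trans_le bot_le) hle)
  · have hmem := mem_support_quotient_smul_top_iff (N := A) (J := Ideal.ofList ys) (p := p)
    rw [smul_eq_mul, Ideal.mul_top] at hmem
    exact le_sup_right.trans (hmem.1 hp)

lemma ker_le_of_isNilpotent_ker (hker : IsNilpotent (RingHom.ker f)) {P : Ideal A}
    (hP : P.IsPrime) : RingHom.ker f ≤ P := by
  obtain ⟨n, hn⟩ := hker
  exact hP.le_of_pow_le (hn.trans_le bot_le)

lemma map_eq_top_iff_of_isNilpotent_ker (hf : Function.Surjective f)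
    (hker : IsNilpotent (RingHom.ker f)) {I : Ideal A} : I.map f = ⊤ ↔ I = ⊤ := by
  refine ⟨fun h => ?_, fun h => h ▸ Ideal.map_top f⟩
  by_contra hI
  obtain ⟨m, hm, hIm⟩ := Ideal.exists_le_maximal I hI
  have hsup : I ⊔ RingHom.ker f = ⊤ := by
    rw [← Ideal.comap_map_of_surjective' f hf, h, Ideal.comap_top]
  exact hm.ne_top (top_le_iff.1
    (hsup.ge.trans (sup_le hIm (ker_le_of_isNilpotent_ker hker hm.isPrime))))

theorem isParameterSeq_map_iff [IsNoetherianRing A] (hf : Function.Surjective f)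
    (hker : IsNilpotent (RingHom.ker f)) {ys : List A} :
    IsParameterSeq B B (ys.map f) ↔ IsParameterSeq A A ys := by
  have := isNoetherianRing_of_surjective A B f hf
  rw [isParameterSeq_self_iff, isParameterSeq_self_iff, ← Ideal.map_ofList, Ne, Ne,
    map_eq_top_iff_of_isNilpotent_ker hf hker]
  refine and_congr_right' ⟨fun h P hP hle => ?_, fun h p hp hle => ?_⟩
  · have hkerP := ker_le_of_isNilpotent_ker hker hP
    have hcomap : (P.map f).comap f = P := by
      rw [Ideal.comap_map_of_surjective' f hf, sup_eq_left.2 hkerP]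
    exact hcomap ▸ topNonzeroAt_of_map hf
      (h _ (Ideal.map_isPrime_of_surjective hf hkerP) (Ideal.map_mono hle))
  · exact topNonzeroAt_map hf hker (h _ (hp.comap f) (Ideal.map_le_iff_le_comap.1 hle))

lemma isStrongParameterSeq_map_iff [IsNoetherianRing A] (hf : Function.Surjective f)
    (hker : IsNilpotent (RingHom.ker f)) {ys : List A} :
    IsStrongParameterSeq B B (ys.map f) ↔ IsStrongParameterSeq A A ys := by
  simp only [IsStrongParameterSeq, List.length_map, ← List.map_take,
    isParameterSeq_map_iff hf hker]

end NilpotentKernel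

section TrivialExtension

open TrivSqZeroExt IsLocalRing

variable {R : Type*} [CommRing R] {M : Type*} [AddCommGroup M] [Module R M] [Module Rᵐᵒᵖ M]
  [IsCentralScalar R M]

lemma isNoetherianRing_trivSqZeroExt [IsNoetherianRing R] [Module.Finite R M] :
    IsNoetherianRing (TrivSqZeroExt R M) :=
  have : Module.Finite R (TrivSqZeroExt R M) := inferInstanceAs (Module.Finite R (R × M))
  IsNoetherianRing.of_finite R (TrivSqZeroExt R M)

lemma fstHom_surjective : Function.Surjective (fstHom R R M) := fun r => ⟨inl r, rfl⟩

lemma isStrongParameterSeq_map_fst_iff [IsNoetherianRing R] [Module.Finite R M]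
    {ys : List (TrivSqZeroExt R M)} :
    IsStrongParameterSeq R R (ys.map fst) ↔
      IsStrongParameterSeq (TrivSqZeroExt R M) (TrivSqZeroExt R M) ys :=
  have := isNoetherianRing_trivSqZeroExt (R := R) (M := M)
  isStrongParameterSeq_map_iff (f := (fstHom R R M).toRingHom) fstHom_surjective
    ⟨2, kerIdeal_sq R M⟩

lemma isWeaklyRegular_of_map_inl {rs : List R}
    (h : IsWeaklyRegular (TrivSqZeroExt R M) (rs.map (inl : R → TrivSqZeroExt R M))) :
    IsWeaklyRegular R rs ∧ IsWeaklyRegular M rs := by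
  have h' : IsWeaklyRegular (TrivSqZeroExt R M) rs :=
    (isWeaklyRegular_map_algebraMap_iff (S := TrivSqZeroExt R M) _ rs).1 h
  exact ⟨isWeaklyRegular_of_leftInverse (f := Algebra.linearMap R (TrivSqZeroExt R M))
      (g := (fstHom R R M).toLinearMap) (fun _ => rfl) h',
    isWeaklyRegular_of_leftInverse (f := inrHom R M) (g := sndHom R M) (fun _ => rfl) h'⟩

variable (R M) in
/-- The square-zero ideal of the trivial extension is, additively, the module; multiplication by
`r` on the ideal corresponds to the action of `r.fst`. -/
def kerIdealAddEquiv : kerIdeal R M ≃+ M where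
  toFun w := w.1.snd
  invFun m := ⟨inr m, fst_inr R m⟩
  left_inv w := Subtype.ext ((mem_kerIdeal_iff_inr R M _).1 w.2).symm
  right_inv _ := rfl
  map_add' _ _ := rfl

lemma kerIdealAddEquiv_smul (r : TrivSqZeroExt R M) (w : kerIdeal R M) :
    kerIdealAddEquiv R M (r • w) = r.fst • kerIdealAddEquiv R M w := by
  have hw : w.1.fst = 0 := w.2
  calc (r * w.1).snd = r.fst • w.1.snd + MulOpposite.op w.1.fst • r.snd := snd_mul _ _
    _ = r.fst • w.1.snd := by rw [hw, MulOpposite.op_zero, zero_smul, add_zero]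

lemma isWeaklyRegular_of_map_fst {ys : List (TrivSqZeroExt R M)}
    (hR : IsWeaklyRegular R (ys.map fst)) (hM : IsWeaklyRegular M (ys.map fst)) :
    IsWeaklyRegular (TrivSqZeroExt R M) ys := by
  refine isWeaklyRegular_of_exact (Submodule.injective_subtype (kerIdeal R M))
    (LinearMap.exact_subtype_mkQ _) (Submodule.mkQ_surjective _) ?_ ?_
  · exact (AddEquiv.isWeaklyRegular_congr (e := kerIdealAddEquiv R M)
      (List.forall₂_map_right_iff.2 (List.forall₂_same.2 fun r _ => kerIdealAddEquiv_smul r))).2 hM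
  · refine (AddEquiv.isWeaklyRegular_congr (e := (RingHom.quotientKerEquivOfSurjective
      (f := (fstHom R R M).toRingHom) fstHom_surjective).toAddEquiv)
      (List.forall₂_map_right_iff.2 (List.forall₂_same.2 fun r _ w => ?_))).2 hR
    obtain ⟨w, rfl⟩ := Submodule.mkQ_surjective _ w
    exact fst_mul r w

lemma IsStrongParameterSeq.ofList_smul_top_ne_top {N : Type*} [AddCommGroup N] [Module R N]
    {rs : List R} (h : IsStrongParameterSeq R N rs) (hne : rs ≠ []) :
    Ideal.ofList rs • (⊤ : Submodule R N) ≠ ⊤ := by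
  simpa only [List.take_length] using
    (h rs.length (List.length_pos_of_ne_nil hne) le_rfl).smul_ne_top

variable [IsNoetherianRing R] [Module.Finite R M]

lemma isWeaklyRegular_of_isCohenMacaulay_trivSqZeroExt
    (h : IsCohenMacaulay (TrivSqZeroExt R M) (TrivSqZeroExt R M)) {rs : List R}
    (hrs : IsStrongParameterSeq R R rs) : IsWeaklyRegular R rs ∧ IsWeaklyRegular M rs := by
  have hmap : (rs.map (inl : R → TrivSqZeroExt R M)).map fst = rs := by
    rw [List.map_map]
    exact List.map_id rs
  refine isWeaklyRegular_of_map_inl ?_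
  rcases h _ (isStrongParameterSeq_map_fst_iff.1 (hmap.symm ▸ hrs)) with hnil | hreg
  · exact hnil ▸ .nil _ _
  · exact hreg.toIsWeaklyRegular

theorem isCohenMacaulay_of_trivSqZeroExt
    (h : IsCohenMacaulay (TrivSqZeroExt R M) (TrivSqZeroExt R M)) : IsCohenMacaulay R R :=
  fun _ hrs => or_iff_not_imp_left.2 fun hne =>
    ⟨(isWeaklyRegular_of_isCohenMacaulay_trivSqZeroExt h hrs).1,
      (hrs.ofList_smul_top_ne_top hne).symm⟩

theorem isRegular_of_isCohenMacaulay_trivSqZeroExt [IsLocalRing R] [Nontrivial M]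
    (h : IsCohenMacaulay (TrivSqZeroExt R M) (TrivSqZeroExt R M)) {rs : List R}
    (hrs : IsRegular R rs) : IsRegular M rs :=
  (isRegular_iff_isWeaklyRegular_of_subset_maximalIdeal
    (mem_maximalIdeal_of_ofList_smul_ne_top hrs.top_ne_smul.symm)).2
    (isWeaklyRegular_of_isCohenMacaulay_trivSqZeroExt h (isStrongParameterSeq_of_isRegular hrs)).2

theorem isCohenMacaulay_trivSqZeroExt (hR : IsCohenMacaulay R R)
    (hM : ∀ rs : List R, IsRegular R rs → IsRegular M rs) :
    IsCohenMacaulay (TrivSqZeroExt R M) (TrivSqZeroExt R M) := by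
  refine fun ys hys => or_iff_not_imp_left.2 fun hne => ?_
  have hreg := (hR _ (isStrongParameterSeq_map_fst_iff.2 hys)).resolve_left
    (by rwa [List.map_eq_nil_iff])
  exact ⟨isWeaklyRegular_of_map_fst hreg.toIsWeaklyRegular (hM _ hreg).toIsWeaklyRegular,
    (hys.ofList_smul_top_ne_top hne).symm⟩

end TrivialExtension

end TrivExtCM

end

theorem mainTheorem2 {R : Type*} [CommRing R] [IsLocalRing R] [IsNoetherianRing R]
    {M : Type*} [AddCommGroup M] [Module R M] [Module Rᵐᵒᵖ M] [IsCentralScalar R M]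
    [Module.Finite R M] [Nontrivial M] :
    List.TFAE [
      TrivExtCM.IsCohenMacaulay (TrivSqZeroExt R M) (TrivSqZeroExt R M),
      TrivExtCM.IsCohenMacaulay R R ∧
        ∀ rs : List R, RingTheory.Sequence.IsRegular R rs → RingTheory.Sequence.IsRegular M rs,
      TrivExtCM.IsCohenMacaulay R R ∧ TrivExtCM.IsMaximalCohenMacaulay R M] := by
  tfae_have 1 → 2 := fun h => ⟨TrivExtCM.isCohenMacaulay_of_trivSqZeroExt h,
    fun _ => TrivExtCM.isRegular_of_isCohenMacaulay_trivSqZeroExt h⟩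
  tfae_have 2 → 1 := fun ⟨hR, hM⟩ => TrivExtCM.isCohenMacaulay_trivSqZeroExt hR hM
  tfae_have 2 → 3 := fun ⟨hR, hM⟩ => ⟨hR, TrivExtCM.isMaximalCohenMacaulay_of_isRegular hR hM⟩
  tfae_have 3 → 2 := fun ⟨hR, hM⟩ =>
    ⟨hR, fun _ => TrivExtCM.isRegular_of_isMaximalCohenMacaulay hM⟩
  tfae_finish
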